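/- **Setting.** Let $V$ be an infinite set of nodes and let $(L,\le)$ be a poset with least element $\bot$ in which every non-empty directed subset has a supremum and every element has only finitely many elements below it. Boolean formulae are built from $\mathsf{true}$, $\mathsf{false}$, $\land$, $\lor$, $\lnot$ and variables in $V$; they are interpreted by valuations $V\to\{0,1\}$ and are identified when logically equivalent. $\psi\Rightarrow\chi$ means that every valuation satisfying $\psi$ satisfies $\chi$. In a strict poset, $\mathrm{succ}(x)$ is the set of immediate successors of $x$, and the level of $x$ is the greatest length of a chain of immediate successors from a minimal element to $x$. A *labelled partial order with formulae* (lpof) is a tuple $\alpha=\langle N_\alpha,<_\alpha,\lambda_\alpha,\varphi_\alpha\rangle$ where $N_\alpha\subseteq V$ is countable; $<_\alpha$ is a strict order on $N_\alpha$ with exactly one minimal node, in which each node has finitely many predecessors and each level is finite; $\lambda_\alpha:N_\alpha\to L$ is such that a node labelled $\bot$ has no immediate successors; and $\varphi_\alpha$ assigns to each node $x$ a satisfiable formula that can be written with variables from $\{y: y<_\alpha x\}$ only, such that $\varphi_\alpha(y)\Rightarrow\varphi_\alpha(x)$ whenever $x<_\alpha y$. Let $\mathrm{Bot}_\alpha=\{x\in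 N_\alpha:\lambda_\alpha(x)=\bot\}$. Write $\alpha\sqsubseteq\beta$ iff $N_\alpha$ is a downward closed subset of $N_\beta$, $<_\alpha$ is the restriction of $<_\beta$ to $N_\alpha$, and for all $x\in N_\alpha$: $\lambda_\alpha(x)\le\lambda_\beta(x)$, $\varphi_\alpha(x)=\varphi_\beta(x)$, and $\mathrm{succ}_\alpha(x)=\mathrm{succ}_\beta(x)\setminus\{y : \exists z\in\mathrm{Bot}_\alpha,\ z<_\beta y\}$. An isomorphism of lpofs is a bijection of the nodes that transports the order, the labels and (by renaming variables) the formulae. A *pomset* is an isomorphism class of lpofs; it is finite if its members have finitely many nodes. Pomsets are ordered by $A\sqsubseteq B$ iff every $\beta\in B$ lies above some $\alpha\in A$. For a finite lpof $\alpha$ let $\mathrm{stuck}_\alpha=\bigvee_{x\in\mathrm{Bot}_\alpha}\varphi_\alpha(x)$, let $\mathrm{ext}_\alpha=\{x\in N_\alpha:\varphi_\alpha(x)\not\Rightarrow\mathrm{stuck}_\alpha\}$, let $\varphi_\alpha(S)=\bigwedge_{x\in S}\varphi_\alpha(x)$, and let $\mathrm{br}_\alpha$ be the set of formulae $\varphi_\alpha(S)$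 with $\emptyset\ne S\subseteq\mathrm{ext}_\alpha$, $\varphi_\alpha(S)$ satisfiable, $\varphi_\alpha(S)\Rightarrow\lnot\mathrm{stuck}_\alpha$, and $\varphi_\alpha(T)$ unsatisfiable for all $T$ with $S\subsetneq T\subseteq\mathrm{ext}_\alpha$. Given finite $\alpha,\beta$ and a family $f=(\beta_\psi)_{\psi\in\mathrm{br}_\alpha}$ of isomorphic copies of $\beta$ whose node sets are disjoint from $N_\alpha$ and from each other, let $\alpha;_f\beta$ be the tuple with nodes $N_\alpha\cup\bigcup_\psi N_{\beta_\psi}$; with order $<_\alpha\cup\bigcup_\psi\big({<_{\beta_\psi}}\cup\{x\in N_\alpha:\psi\Rightarrow\varphi_\alpha(x)\}\times N_{\beta_\psi}\big)$; with label $\lambda_\alpha(x)$ and formula $\varphi_\alpha(x)$ at $x\in N_\alpha$; and with label $\lambda_{\beta_\psi}(x)$ and formula $\varphi_{\beta_\psi}(x)\land\psi$ at $x\in N_{\beta_\psi}$. **Statement.** 1. $\sqsubseteq$ is a partial order on pomsets, and every directed set of pomsets (the empty set included) has a supremum. 2. For finite pomsets $A,B$, the set $$A;B=\{\alpha;_f\beta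 \mid \alpha\in A,\ \beta\in B,\ f \text{ a family of copies as above}\}$$ is a finite pomset. 3. On finite pomsets, $A\sqsubseteq A'$ and $B\sqsubseteq B'$ imply $A;B\sqsubseteq A';B'$. 4. For arbitrary pomsets $A,B$, the iterated supremum $$A;B=\sup_{A'\sqsubseteq A,\ A'\text{ finite}}\ \ \sup_{B'\sqsubseteq B,\ B'\text{ finite}} A';B'$$ exists, and it agrees with the composition in 2 when $A$ and $B$ are finite. The map $(A,B)\mapsto A;B$ so defined is Scott continuous: for every non-empty directed set $D$ of pairs of pomsets (ordered componentwise) with supremum $p$, the image of $D$ under the map has the image of $p$ as its supremum (so the map is monotone). It also preserves the supremum of the empty set: if $\bot$ is the least pomset, then $\bot;\bot=\bot$. -/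

import Mathlib

namespace Pomset

/-! ## Boolean formulae over nodes -/

/-- Syntax of Boolean formulae with the elements of `V` as variables. -/
inductive FormExpr (V : Type*) where
  | tru : FormExpr V
  | fls : FormExpr V
  | and : FormExpr V → FormExpr V → FormExpr V
  | or : FormExpr V → FormExpr V → FormExpr V
  | not : FormExpr V → FormExpr V
  | var : V → FormExpr V

namespace FormExpr

/-- Satisfaction of a formula by a valuation. -/
def Holds {V : Type*} (v : V → Bool) : FormExpr V → Prop
  | tru => True
  | fls => False
  | and a b => a.Holds v ∧ b.Holds v
  | or a b => a.Holds v ∨ b.Holds v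
  | not a => ¬ a.Holds v
  | var x => v x = true

/-- The variables that occur in a formula. -/
def free {V : Type*} : FormExpr V → Set V
  | tru => ∅
  | fls => ∅
  | and a b => a.free ∪ b.free
  | or a b => a.free ∪ b.free
  | not a => a.free
  | var x => {x}

/-- Renaming of the variables of a formula. -/
def rename {V W : Type*} (f : V → W) : FormExpr V → FormExpr W
  | tru => tru
  | fls => fls
  | and a b => and (a.rename f) (b.rename f)
  | or a b => or (a.rename f) (b.rename f)
  | not a => not (a.rename f)
  | var x => var (f x)

theorem holds_rename {V W : Type*} (f : V → W) (v : W → Bool) (a : FormExpr V) :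
    (a.rename f).Holds v ↔ a.Holds (v ∘ f) := by
  induction a <;> simp_all [rename, Holds]

/-- Logical equivalence of formulae. -/
instance equiv (V : Type*) : Setoid (FormExpr V) where
  r a b := ∀ v : V → Bool, a.Holds v ↔ b.Holds v
  iseqv := ⟨fun _ _ => Iff.rfl, fun h v => (h v).symm, fun h h' v => (h v).trans (h' v)⟩

end FormExpr

/-- Boolean formulae, taken up to logical equivalence. -/
def Form (V : Type*) : Type _ := Quotient (FormExpr.equiv V)

namespace Form

/-- The formula `true`. -/
def tru {V : Type*} : Form V := Quotient.mk _ FormExpr.tru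

/-- The formula `false`. -/
def fls {V : Type*} : Form V := Quotient.mk _ FormExpr.fls

/-- Conjunction. -/
def and {V : Type*} : Form V → Form V → Form V :=
  Quotient.map₂ FormExpr.and fun _ _ h _ _ h' v => and_congr (h v) (h' v)

/-- Disjunction. -/
def or {V : Type*} : Form V → Form V → Form V :=
  Quotient.map₂ FormExpr.or fun _ _ h _ _ h' v => or_congr (h v) (h' v)

/-- Negation. -/
def not {V : Type*} : Form V → Form V :=
  Quotient.map FormExpr.not fun a b (h : ∀ v, a.Holds v ↔ b.Holds v) v => not_congr (h v)

/-- Renaming of variables. -/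
def rename {V W : Type*} (f : V → W) : Form V → Form W :=
  Quotient.map (FormExpr.rename f) fun a b (h : ∀ v, a.Holds v ↔ b.Holds v) v =>
    (FormExpr.holds_rename f v a).trans ((h _).trans (FormExpr.holds_rename f v b).symm)

/-- `ψ.Holds v`: the valuation `v` satisfies `ψ`. -/
def Holds {V : Type*} (ψ : Form V) (v : V → Bool) : Prop :=
  Quotient.lift (FormExpr.Holds v)
    (fun a b (h : ∀ v, a.Holds v ↔ b.Holds v) => propext (h v)) ψ

/-- `ψ` is satisfiable. -/
def Sat {V : Type*} (ψ : Form V) : Prop := ∃ v, ψ.Holds v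

/-- `ψ` implies `χ`. -/
def Implies {V : Type*} (ψ χ : Form V) : Prop := ∀ v, ψ.Holds v → χ.Holds v

/-- `ψ` can be written with variables from `X` only. -/
def FreeIn {V : Type*} (ψ : Form V) (X : Set V) : Prop :=
  ∃ a : FormExpr V, ψ = Quotient.mk _ a ∧ a.free ⊆ X

/-- The elements of a finite set, as a list (and `[]` for an infinite set, which is never used). -/
noncomputable def finList {V : Type*} (S : Set V) : List V :=
  open Classical in if h : S.Finite then h.toFinset.toList else []

/-- The conjunction of `φ x` over the `x` in a finite set `S`. -/
noncomputable def bigAnd {V : Type*} (φ : V → Form V) (S : Set V) : Form V :=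
  ((finList S).map φ).foldr and tru

/-- The disjunction of `φ x` over the `x` in a finite set `S`. -/
noncomputable def bigOr {V : Type*} (φ : V → Form V) (S : Set V) : Form V :=
  ((finList S).map φ).foldr or fls

end Form

/-! ## Labelled partial orders with formulae -/

/-- A tuple of nodes, order, labels and formulae. The conditions on it are in `IsLPO`. -/
@[ext] structure PreLPO (V L : Type*) where
  /-- the nodes -/
  N : Set V
  /-- the strict order on the nodes -/
  lt : V → V → Prop
  /-- the labelling -/
  lab : V → L
  /-- the formulae -/
  form : V → Form V

namespace PreLPO

/-- Strict upward closure of a node. -/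
def up {V L : Type*} (α : PreLPO V L) (x : V) : Set V := {y | y ∈ α.N ∧ α.lt x y}

/-- Strict downward closure of a node. -/
def down {V L : Type*} (α : PreLPO V L) (x : V) : Set V := {y | y ∈ α.N ∧ α.lt y x}

/-- Strict upward closure of a set of nodes. -/
def upSet {V L : Type*} (α : PreLPO V L) (X : Set V) : Set V := {y | ∃ x ∈ X, y ∈ α.up x}

/-- Immediate successors. -/
def succ {V L : Type*} (α : PreLPO V L) (x : V) : Set V :=
  {y | y ∈ α.up x ∧ ¬ ∃ z ∈ α.N, α.lt x z ∧ α.lt z y}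

/-- Immediate predecessors. -/
def pred {V L : Type*} (α : PreLPO V L) (x : V) : Set V :=
  {y | y ∈ α.down x ∧ ¬ ∃ z ∈ α.N, α.lt y z ∧ α.lt z x}

/-- Minimal nodes. -/
def minNodes {V L : Type*} (α : PreLPO V L) : Set V := {x | x ∈ α.N ∧ α.pred x = ∅}

/-- The level of a node: the greatest length of a chain of immediate successors that leads from
a minimal node to it (the lengths are bounded when the order is finitely preceded). -/
noncomputable def lev {V L : Type*} (α : PreLPO V L) (x : V) : ℕ :=
  sSup {n | ∃ c : ℕ → V, c 0 ∈ α.minNodes ∧ c n = x ∧ ∀ i < n, c (i + 1) ∈ α.succ (c i)}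

/-- The nodes labelled with the bottom element. -/
def bots {V L : Type*} [LE L] [OrderBot L] (α : PreLPO V L) : Set V := {x | x ∈ α.N ∧ α.lab x = ⊥}

/-- The tuple is a labelled partial order with formulae. The order relates nodes only, and labels
and formulae have a fixed value outside the set of nodes, so that two such tuples are equal iff
they have the same nodes, order, labels on nodes and formulae on nodes. -/
structure IsLPO {V L : Type*} [LE L] [OrderBot L] (α : PreLPO V L) : Prop where
  lt_mem : ∀ x y, α.lt x y → x ∈ α.N ∧ y ∈ α.N
  lab_out : ∀ x, x ∉ α.N → α.lab x = ⊥
  form_out : ∀ x, x ∉ α.N → α.form x = Form.tru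
  countable : α.N.Countable
  irrefl : ∀ x, ¬ α.lt x x
  trans : ∀ x y z, α.lt x y → α.lt y z → α.lt x z
  finitely_preceded : ∀ x ∈ α.N, (α.down x).Finite
  finite_level : ∀ n : ℕ, {x | x ∈ α.N ∧ α.lev x = n}.Finite
  rooted : ∃ r, α.minNodes = {r}
  lab_bot : ∀ x ∈ α.N, α.lab x = ⊥ → α.succ x = ∅
  sat : ∀ x ∈ α.N, (α.form x).Sat
  free : ∀ x ∈ α.N, (α.form x).FreeIn (α.down x)
  form_mono : ∀ x y, α.lt x y → (α.form y).Implies (α.form x)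

end PreLPO

/-- Labelled partial orders with formulae, with nodes in `V` and labels in `L`. -/
def LPO (V L : Type*) [LE L] [OrderBot L] : Type _ := {α : PreLPO V L // α.IsLPO}

namespace LPO

/-- The order on labelled partial orders with formulae. -/
structure Le {V L : Type*} [LE L] [OrderBot L] (α β : LPO V L) : Prop where
  subset : α.1.N ⊆ β.1.N
  down_closed : ∀ x ∈ α.1.N, β.1.down x ⊆ α.1.N
  lt_iff : ∀ x y, α.1.lt x y ↔ β.1.lt x y ∧ x ∈ α.1.N ∧ y ∈ α.1.N
  lab_le : ∀ x ∈ α.1.N, α.1.lab x ≤ β.1.lab x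
  form_eq : ∀ x ∈ α.1.N, α.1.form x = β.1.form x
  succ_eq : ∀ x ∈ α.1.N, α.1.succ x = β.1.succ x \ β.1.upSet α.1.bots

/-- Isomorphism: a bijection between the nodes that transports order, labels and formulae. -/
def Iso {V L : Type*} [LE L] [OrderBot L] (α β : LPO V L) : Prop :=
  ∃ f : V → V, Set.BijOn f α.1.N β.1.N ∧
    (∀ x ∈ α.1.N, ∀ y ∈ α.1.N, β.1.lt (f x) (f y) ↔ α.1.lt x y) ∧
    (∀ x ∈ α.1.N, β.1.lab (f x) = α.1.lab x) ∧
    (∀ x ∈ α.1.N, β.1.form (f x) = (α.1.form x).rename f)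

theorem exists_succ_le {V L : Type*} [LE L] [OrderBot L] (α : LPO V L) {w x : V}
    (h : α.1.lt w x) : ∃ y ∈ α.1.succ w, y = x ∨ α.1.lt y x := by
  have hx := (α.2.lt_mem _ _ h).2
  let T : Set V := {y | y ∈ α.1.N ∧ α.1.lt w y ∧ (y = x ∨ α.1.lt y x)}
  have hT : T.Finite := by
    refine ((α.2.finitely_preceded x hx).union (Set.finite_singleton x)).subset ?_
    rintro y ⟨h1, h2, h3 | h3⟩
    · exact Or.inr h3
    · exact Or.inl ⟨h1, h3⟩
  have hlt : IsStrictOrder V α.1.lt := { irrefl := α.2.irrefl, trans := α.2.trans }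
  obtain ⟨y, hy, hmin⟩ := (hT.wellFoundedOn (r := α.1.lt)).has_min
    (s := (Set.univ : Set T)) ⟨⟨x, hx, h, Or.inl rfl⟩, trivial⟩
  refine ⟨y.1, ⟨⟨y.2.1, y.2.2.1⟩, ?_⟩, y.2.2.2⟩
  rintro ⟨z, hz, hwz, hzy⟩
  refine hmin ⟨z, hz, hwz, Or.inr ?_⟩ trivial hzy
  rcases y.2.2.2 with e | e
  · exact e ▸ hzy
  · exact α.2.trans _ _ _ hzy e

theorem not_lt_of_bot {V L : Type*} [LE L] [OrderBot L] (α : LPO V L) {w x : V}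
    (hw : w ∈ α.1.bots) : ¬ α.1.lt w x := fun h => by
  obtain ⟨y, hy, -⟩ := α.exists_succ_le h
  rw [α.2.lab_bot w hw.1 hw.2] at hy
  exact hy

theorem exists_root_le {V L : Type*} [LE L] [OrderBot L] (α : LPO V L) :
    ∃ r ∈ α.1.N, ∀ x ∈ α.1.N, r = x ∨ α.1.lt r x := by
  obtain ⟨r, hr⟩ := α.2.rooted
  have hrm : r ∈ α.1.minNodes := hr ▸ rfl
  refine ⟨r, hrm.1, fun x hx => ?_⟩
  let T : Set V := {y | y ∈ α.1.N ∧ (y = x ∨ α.1.lt y x)}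
  have hT : T.Finite := by
    refine ((α.2.finitely_preceded x hx).union (Set.finite_singleton x)).subset ?_
    rintro y ⟨h1, h3 | h3⟩
    · exact Or.inr h3
    · exact Or.inl ⟨h1, h3⟩
  have hlt : IsStrictOrder V α.1.lt := { irrefl := α.2.irrefl, trans := α.2.trans }
  obtain ⟨y, hy, hmin⟩ := (hT.wellFoundedOn (r := α.1.lt)).has_min
    (s := (Set.univ : Set T)) ⟨⟨x, hx, Or.inl rfl⟩, trivial⟩
  have : y.1 ∈ α.1.minNodes := by
    refine ⟨y.2.1, Set.eq_empty_of_forall_notMem ?_⟩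
    rintro z ⟨⟨hz, hzy⟩, -⟩
    refine hmin ⟨z, hz, Or.inr ?_⟩ trivial hzy
    rcases y.2.2 with e | e
    · exact e ▸ hzy
    · exact α.2.trans _ _ _ hzy e
  rw [hr] at this
  rw [← show y.1 = r from this]
  exact y.2.2

/-- The nodes of `β` that are missing in a smaller `α` lie above a bottom node of `α`. -/
theorem Le.missing {V L : Type*} [LE L] [OrderBot L] {α β : LPO V L} (h : Le α β) {x : V}
    (hx : x ∈ β.1.N) (hxα : x ∉ α.1.N) : x ∈ β.1.upSet α.1.bots := by
  obtain ⟨a, ha, -⟩ := α.exists_root_le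
  obtain ⟨r, hr, hrx⟩ := β.exists_root_le
  have hrα : r ∈ α.1.N := by
    rcases hrx a (h.subset ha) with e | e
    · exact e ▸ ha
    · exact h.down_closed a ha ⟨hr, e⟩
  have hrx' : β.1.lt r x := (hrx x hx).resolve_left (fun e => hxα (e ▸ hrα))
  let T : Set V := {w | w ∈ α.1.N ∧ β.1.lt w x}
  have hT : T.Finite := (β.2.finitely_preceded x hx).subset fun w hw => ⟨h.subset hw.1, hw.2⟩
  have hlt : IsStrictOrder V (Function.swap β.1.lt) :=
    { irrefl := β.2.irrefl, trans := fun _ _ _ h1 h2 => β.2.trans _ _ _ h2 h1 }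
  obtain ⟨w, -, hmax⟩ := (hT.wellFoundedOn (r := Function.swap β.1.lt)).has_min
    (s := (Set.univ : Set T)) ⟨⟨r, hrα, hrx'⟩, trivial⟩
  obtain ⟨y, hy, hyx⟩ := β.exists_succ_le w.2.2
  have hyα : y ∉ α.1.N := by
    intro hyα
    rcases hyx with e | e
    · exact hxα (e ▸ hyα)
    · exact hmax ⟨y, hyα, e⟩ trivial hy.1.2
  have hy' : y ∈ β.1.upSet α.1.bots := by
    by_contra hc
    have : y ∈ α.1.succ w.1 := by rw [h.succ_eq _ w.2.1]; exact ⟨hy, hc⟩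
    exact hyα this.1.1
  obtain ⟨z, hz, hzy⟩ := hy'
  refine ⟨z, hz, hx, ?_⟩
  rcases hyx with e | e
  · exact e ▸ hzy.2
  · exact β.2.trans _ _ _ hzy.2 e

theorem Le.refl {V L : Type*} [PartialOrder L] [OrderBot L] (α : LPO V L) : Le α α where
  subset := le_rfl
  down_closed := fun _ _ _ hy => hy.1
  lt_iff := fun x y => ⟨fun h => ⟨h, α.2.lt_mem x y h⟩, fun h => h.1⟩
  lab_le := fun _ _ => le_rfl
  form_eq := fun _ _ => rfl
  succ_eq := fun x _ => by
    symm
    refine Set.Subset.antisymm (fun y hy => hy.1) fun y hy => ⟨hy, ?_⟩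
    rintro ⟨z, hz, hzy⟩
    exact α.not_lt_of_bot hz hzy.2

theorem Le.trans {V L : Type*} [PartialOrder L] [OrderBot L] {α β γ : LPO V L}
    (h : Le α β) (h' : Le β γ) : Le α γ where
  subset := h.subset.trans h'.subset
  down_closed := fun x hx y hy =>
    have hyβ := h'.down_closed x (h.subset hx) hy
    h.down_closed x hx ⟨hyβ, (h'.lt_iff _ _).2 ⟨hy.2, hyβ, h.subset hx⟩⟩
  lt_iff := fun x y => by
    rw [h.lt_iff, h'.lt_iff]
    exact ⟨fun k => ⟨k.1.1, k.2⟩, fun k => ⟨⟨k.1, h.subset k.2.1, h.subset k.2.2⟩, k.2⟩⟩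
  lab_le := fun x hx => (h.lab_le x hx).trans (h'.lab_le x (h.subset hx))
  form_eq := fun x hx => (h.form_eq x hx).trans (h'.form_eq x (h.subset hx))
  succ_eq := fun x hx => by
    rw [h.succ_eq x hx, h'.succ_eq x (h.subset hx)]
    ext y
    constructor
    · rintro ⟨⟨h1, h2⟩, h3⟩
      refine ⟨h1, ?_⟩
      rintro ⟨z, hz, hzy⟩
      by_cases hyβ : y ∈ β.1.N
      · exact h3 ⟨z, hz, hyβ, (h'.lt_iff _ _).2 ⟨hzy.2, h.subset hz.1, hyβ⟩⟩
      · exact h2 (h'.missing hzy.1 hyβ)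
    · rintro ⟨h1, h2⟩
      have hyα : y ∈ α.1.N := by
        by_contra hyα
        by_cases hyβ : y ∈ β.1.N
        · obtain ⟨z, hz, hzy⟩ := h.missing hyβ hyα
          exact h2 ⟨z, hz, h1.1.1, ((h'.lt_iff _ _).1 hzy.2).1⟩
        · obtain ⟨z, hz, hzy⟩ := h'.missing h1.1.1 hyβ
          by_cases hzα : z ∈ α.1.N
          · exact h2 ⟨z, ⟨hzα, le_bot_iff.1 ((h.lab_le z hzα).trans hz.2.le)⟩, hzy⟩
          · obtain ⟨u, hu, huz⟩ := h.missing hz.1 hzα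
            exact h2 ⟨u, hu, hzy.1, γ.2.trans _ _ _ ((h'.lt_iff _ _).1 huz.2).1 hzy.2⟩
      refine ⟨⟨h1, ?_⟩, ?_⟩
      · rintro ⟨z, hz, hzy⟩
        exact β.not_lt_of_bot hz ((h'.lt_iff _ _).2 ⟨hzy.2, hz.1, h.subset hyα⟩)
      · rintro ⟨z, hz, hzy⟩
        exact α.not_lt_of_bot hz ((h.lt_iff _ _).2 ⟨hzy.2, hz.1, hyα⟩)

end LPO

/-! ## Pomsets with formulae -/

/-- A pomset with formulae: an isomorphism class of labelled partial orders with formulae. -/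
def Pom (V L : Type*) [LE L] [OrderBot L] : Type _ :=
  {A : Set (LPO V L) // ∃ α : LPO V L, A = {β | LPO.Iso α β}}

/-- `A ≤ B` iff every representative of `B` lies above a representative of `A`. -/
instance Pom.instPreorder {V L : Type*} [PartialOrder L] [OrderBot L] : Preorder (Pom V L) where
  le A B := ∀ β ∈ B.1, ∃ α ∈ A.1, LPO.Le α β
  le_refl _ := fun β hβ => ⟨β, hβ, LPO.Le.refl β⟩
  le_trans _ _ _ h h' := fun γ hγ =>
    let ⟨β, hβ, hβγ⟩ := h' γ hγ
    let ⟨α, hα, hαβ⟩ := h β hβ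
    ⟨α, hα, hαβ.trans hβγ⟩

/-- The finite pomsets. -/
def FinPom (V L : Type*) [LE L] [OrderBot L] : Type _ :=
  {A : Pom V L // ∀ α ∈ A.1, α.1.N.Finite}

instance FinPom.instPreorder {V L : Type*} [PartialOrder L] [OrderBot L] :
    Preorder (FinPom V L) := Preorder.lift Subtype.val

/-! ## Sequential composition of finite pomsets -/

namespace LPO

/-- The formula that says that some bottom node is reached. -/
noncomputable def stuck {V L : Type*} [LE L] [OrderBot L] (α : LPO V L) : Form V :=
  Form.bigOr α.1.form α.1.bots

/-- The extensible nodes. -/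
noncomputable def extens {V L : Type*} [LE L] [OrderBot L] (α : LPO V L) : Set V :=
  {x | x ∈ α.1.N ∧ ¬ (α.1.form x).Implies α.stuck}

/-- The branches: the satisfiable conjunctions of the formulae of a maximal non-empty set of
extensible nodes that exclude being stuck. -/
noncomputable def br {V L : Type*} [LE L] [OrderBot L] (α : LPO V L) : Set (Form V) :=
  {ψ | ∃ S : Set V, S.Nonempty ∧ S ⊆ α.extens ∧ ψ = Form.bigAnd α.1.form S ∧ ψ.Sat ∧
    ψ.Implies α.stuck.not ∧
    ∀ T : Set V, S ⊂ T → T ⊆ α.extens → ¬ (Form.bigAnd α.1.form T).Sat}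

/-- `f` assigns to each branch of `α` an isomorphic copy of `β`, and the copies have no nodes in
common with `α` and with each other. (The values of `f` at other formulae are not used.) -/
def IsCopy {V L : Type*} [LE L] [OrderBot L] (α β : LPO V L) (f : Form V → LPO V L) : Prop :=
  ∀ ψ ∈ α.br, Iso β (f ψ) ∧ Disjoint (f ψ).1.N α.1.N ∧
    ∀ ψ' ∈ α.br, ψ' ≠ ψ → Disjoint (f ψ).1.N (f ψ').1.N

open Classical in
/-- Sequential composition of `α` with the copies `f ψ`, where `ψ` ranges over the branches. -/
noncomputable def seqAlong {V L : Type*} [LE L] [OrderBot L] (α : LPO V L)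
    (f : Form V → LPO V L) : PreLPO V L where
  N := α.1.N ∪ {x | ∃ ψ ∈ α.br, x ∈ (f ψ).1.N}
  lt x y := α.1.lt x y ∨ ∃ ψ ∈ α.br, (f ψ).1.lt x y ∨
    (x ∈ α.1.N ∧ ψ.Implies (α.1.form x) ∧ y ∈ (f ψ).1.N)
  lab x := if x ∈ α.1.N then α.1.lab x
    else if h : ∃ ψ ∈ α.br, x ∈ (f ψ).1.N then (f h.choose).1.lab x else ⊥
  form x := if x ∈ α.1.N then α.1.form x
    else if h : ∃ ψ ∈ α.br, x ∈ (f ψ).1.N then ((f h.choose).1.form x).and h.choose else Form.tru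

end LPO

/-- All the sequential compositions of a representative of `A` with copies of a representative
of `B`. -/
def FinPom.seqSet {V L : Type*} [LE L] [OrderBot L] (A B : FinPom V L) : Set (PreLPO V L) :=
  {γ | ∃ α ∈ A.1.1, ∃ β ∈ B.1.1, ∃ f, LPO.IsCopy α β f ∧ γ = α.seqAlong f}

end Pomset

/-!
An isomorphism of `α` with a tuple below `β` is a map `k` of the nodes, called an embedding
(`PreLPO.Emb`), and `A ≤ B` holds for pomsets iff a representative of `A` embeds in a
representative of `B` (`cls_le_iff`). In this form the condition of `LPO.Le` on immediate successors
says that every node of `β` outside the image lies above the image of a bottom node of `α`.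
Embeddings preserve levels (`PreLPO.OrderEmb.lev_eq`), and levels are finite. This gives:

* Antisymmetry. Two opposite embeddings compose to a self-embedding, which permutes every level and
  so has to preserve labels (`LPO.Emb.self`).
* Approximation. Every `α` is determined by its truncations `LPO.trunc α n` to finitely many levels:
  if all of them embed in `β`, then the embeddings have a limit along an ultrafilter
  (`LPO.exists_emb_of_trunc`). Thus a pomset is determined by the finite pomsets below it
  (`Pom.le_of_forall_fin`), and these are directed (`FinPom.exists_le_le`).
* Suprema. The hypotheses on `L` exclude infinite ascending chains. Hence, in a non-empty set `D` of
  pomsets, one can pass to larger and larger members whose nodes of level below `n`, with their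
  labels, are final within `D` (`Settled.exists_succ`). As `V` is infinite, representatives can be
  chosen to form a chain for `Le`; its union is a supremum of `D` when `D` is directed, and a finite
  pomset below the supremum lies below a member of the chain (`Pom.exists_isLUB_of_nonempty`). So
  finite pomsets are compact.

For the composition of finite pomsets, let `α ≤ α'`. Nodes that `α'` adds lie above bottom nodes of
`α`, and so their formulae imply `α.stuck`. Therefore the branches of `α` are branches of `α'`
(`LPO.Le.br_subset`), while a new branch passes through a bottom node of `α`
(`LPO.Le.exists_bot_of_mem_br`), so that the nodes of its copy may be absent from the smaller
composition. This is monotonicity (`LPO.Le.seqAlong_le`). The iterated suprema are then suprema of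
directed sets, and Scott continuity is the compactness of the finite pomsets.
-/

namespace Pomset

/-! ### Formulae, renaming and variables -/

namespace FormExpr

theorem holds_congr {V : Type*} {v w : V → Bool} (a : FormExpr V) (h : ∀ x ∈ a.free, v x = w x) :
    a.Holds v ↔ a.Holds w := by
  induction a with
  | tru => exact Iff.rfl
  | fls => exact Iff.rfl
  | and a b iha ihb =>
    exact and_congr (iha fun x hx => h x (Or.inl hx)) (ihb fun x hx => h x (Or.inr hx))
  | or a b iha ihb =>
    exact or_congr (iha fun x hx => h x (Or.inl hx)) (ihb fun x hx => h x (Or.inr hx))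
  | not a ih => exact not_congr (ih h)
  | var x => simp only [Holds]; rw [h x rfl]

theorem free_rename {V W : Type*} (f : V → W) (a : FormExpr V) :
    (a.rename f).free = f '' a.free := by
  induction a <;> simp_all [rename, free, Set.image_union]

end FormExpr

namespace Form

variable {V W : Type*}

theorem ext_holds {ψ χ : Form V} (h : ∀ v, ψ.Holds v ↔ χ.Holds v) : ψ = χ := by
  induction ψ using Quotient.inductionOn
  induction χ using Quotient.inductionOn
  exact Quotient.sound h

@[simp] theorem holds_tru (v : V → Bool) : (tru : Form V).Holds v ↔ True := Iff.rfl

@[simp] theorem holds_fls (v : V → Bool) : (fls : Form V).Holds v ↔ False := Iff.rfl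

@[simp] theorem holds_and (ψ χ : Form V) (v : V → Bool) :
    (ψ.and χ).Holds v ↔ ψ.Holds v ∧ χ.Holds v := by
  induction ψ using Quotient.inductionOn
  induction χ using Quotient.inductionOn
  exact Iff.rfl

@[simp] theorem holds_or (ψ χ : Form V) (v : V → Bool) :
    (ψ.or χ).Holds v ↔ ψ.Holds v ∨ χ.Holds v := by
  induction ψ using Quotient.inductionOn
  induction χ using Quotient.inductionOn
  exact Iff.rfl

@[simp] theorem holds_not (ψ : Form V) (v : V → Bool) : ψ.not.Holds v ↔ ¬ ψ.Holds v := by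
  induction ψ using Quotient.inductionOn
  exact Iff.rfl

@[simp] theorem holds_rename (f : V → W) (ψ : Form V) (v : W → Bool) :
    (ψ.rename f).Holds v ↔ ψ.Holds (v ∘ f) := by
  induction ψ using Quotient.inductionOn
  exact FormExpr.holds_rename f v _

theorem FreeIn.holds_congr {ψ : Form V} {X : Set V} (hψ : ψ.FreeIn X) {v w : V → Bool}
    (h : ∀ x ∈ X, v x = w x) : ψ.Holds v ↔ ψ.Holds w := by
  obtain ⟨a, rfl, ha⟩ := hψ
  exact a.holds_congr fun x hx => h x (ha hx)

theorem FreeIn.mono {ψ : Form V} {X Y : Set V} (hψ : ψ.FreeIn X) (h : X ⊆ Y) : ψ.FreeIn Y :=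
  let ⟨a, e, ha⟩ := hψ
  ⟨a, e, ha.trans h⟩

theorem FreeIn.tru (X : Set V) : (tru : Form V).FreeIn X :=
  ⟨FormExpr.tru, rfl, Set.empty_subset _⟩

theorem FreeIn.and {ψ χ : Form V} {X : Set V} (hψ : ψ.FreeIn X) (hχ : χ.FreeIn X) :
    (ψ.and χ).FreeIn X := by
  obtain ⟨a, rfl, ha⟩ := hψ
  obtain ⟨b, rfl, hb⟩ := hχ
  exact ⟨a.and b, rfl, Set.union_subset ha hb⟩

theorem FreeIn.rename {ψ : Form V} {X : Set V} (hψ : ψ.FreeIn X) (f : V → W) :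
    (ψ.rename f).FreeIn (f '' X) := by
  obtain ⟨a, rfl, ha⟩ := hψ
  exact ⟨a.rename f, rfl, by rw [FormExpr.free_rename]; exact Set.image_mono ha⟩

theorem FreeIn.rename_congr {ψ : Form V} {X : Set V} (hψ : ψ.FreeIn X) {f g : V → W}
    (h : ∀ x ∈ X, f x = g x) : ψ.rename f = ψ.rename g :=
  ext_holds fun v => by
    rw [holds_rename, holds_rename]
    exact hψ.holds_congr fun x hx => congrArg v (h x hx)

theorem FreeIn.rename_eq_self {ψ : Form V} {X : Set V} (hψ : ψ.FreeIn X) {f : V → V}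
    (h : ∀ x ∈ X, f x = x) : ψ.rename f = ψ :=
  ext_holds fun v => by
    rw [holds_rename]
    exact hψ.holds_congr fun x hx => congrArg v (h x hx)

theorem rename_rename {U : Type*} (f : V → W) (g : W → U) (ψ : Form V) :
    (ψ.rename f).rename g = ψ.rename (g ∘ f) :=
  ext_holds fun v => by simp [Function.comp_assoc]

/-- A satisfiable formula without variables is `true`. -/
theorem FreeIn.eq_tru {ψ : Form V} (hψ : ψ.FreeIn ∅) (hs : ψ.Sat) : ψ = Form.tru := by
  obtain ⟨v, hv⟩ := hs
  exact ext_holds fun w => iff_of_true ((hψ.holds_congr (by simp)).1 hv) trivial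

theorem exists_comp_eq_on [Nonempty V] {f : V → W} {X : Set V} (hf : X.InjOn f) (v : V → Bool) :
    ∃ w : W → Bool, ∀ x ∈ X, (w ∘ f) x = v x :=
  ⟨v ∘ Function.invFunOn f X, fun _ hx => congrArg v (hf.leftInvOn_invFunOn hx)⟩

theorem FreeIn.sat_rename [Nonempty V] {ψ : Form V} {X : Set V} (hψ : ψ.FreeIn X) {f : V → W}
    (hf : X.InjOn f) : (ψ.rename f).Sat ↔ ψ.Sat := by
  constructor
  · rintro ⟨v, hv⟩
    exact ⟨_, (holds_rename _ _ _).1 hv⟩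
  · rintro ⟨v, hv⟩
    obtain ⟨w, hw⟩ := exists_comp_eq_on hf v
    exact ⟨w, (holds_rename _ _ _).2 ((hψ.holds_congr hw).2 hv)⟩

theorem FreeIn.implies_rename [Nonempty V] {ψ χ : Form V} {X : Set V} (hψ : ψ.FreeIn X)
    (hχ : χ.FreeIn X) {f : V → W} (hf : X.InjOn f) :
    (ψ.rename f).Implies (χ.rename f) ↔ ψ.Implies χ := by
  constructor
  · intro h v hv
    obtain ⟨w, hw⟩ := exists_comp_eq_on hf v
    have := h w ((holds_rename _ _ _).2 ((hψ.holds_congr hw).2 hv))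
    exact (hχ.holds_congr hw).1 ((holds_rename _ _ _).1 this)
  · intro h v hv
    exact (holds_rename _ _ _).2 (h _ ((holds_rename _ _ _).1 hv))

/-- Satisfiable formulae without common variables are jointly satisfiable. -/
theorem FreeIn.sat_and {ψ χ : Form V} {X Y : Set V} (hψ : ψ.FreeIn X) (hχ : χ.FreeIn Y)
    (hd : Disjoint X Y) (hs : ψ.Sat) (hs' : χ.Sat) : (ψ.and χ).Sat := by
  classical
  obtain ⟨v, hv⟩ := hs
  obtain ⟨w, hw⟩ := hs'
  refine ⟨fun x => if x ∈ X then v x else w x, (holds_and _ _ _).2 ⟨?_, ?_⟩⟩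
  · exact (hψ.holds_congr fun x hx => by simp [hx]).2 hv
  · exact (hχ.holds_congr fun x hx => by simp [Set.disjoint_right.1 hd hx]).2 hw

theorem mem_finList {S : Set V} (hS : S.Finite) {x : V} : x ∈ finList S ↔ x ∈ S := by
  simp [finList, hS]

theorem holds_bigAnd {φ : V → Form V} {S : Set V} (hS : S.Finite) (v : V → Bool) :
    (bigAnd φ S).Holds v ↔ ∀ x ∈ S, (φ x).Holds v := by
  have : ∀ l : List V, ((l.map φ).foldr and tru).Holds v ↔ ∀ x ∈ l, (φ x).Holds v := by
    intro l
    induction l <;> simp_all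
  rw [bigAnd, this]
  simp only [mem_finList hS]

theorem holds_bigOr {φ : V → Form V} {S : Set V} (hS : S.Finite) (v : V → Bool) :
    (bigOr φ S).Holds v ↔ ∃ x ∈ S, (φ x).Holds v := by
  have : ∀ l : List V, ((l.map φ).foldr or fls).Holds v ↔ ∃ x ∈ l, (φ x).Holds v := by
    intro l
    induction l <;> simp_all
  rw [bigOr, this]
  simp only [mem_finList hS]

theorem FreeIn.bigAnd {φ : V → Form V} {S X : Set V} (hS : S.Finite)
    (h : ∀ x ∈ S, (φ x).FreeIn X) : (bigAnd φ S).FreeIn X := by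
  have : ∀ l : List V, (∀ x ∈ l, (φ x).FreeIn X) →
      ((l.map φ).foldr Form.and Form.tru).FreeIn X := by
    intro l hl
    induction l with
    | nil => exact FreeIn.tru X
    | cons a l ih =>
      exact (hl a (by simp)).and (ih fun x hx => hl x (by simp [hx]))
  exact this _ fun x hx => h x ((mem_finList hS).1 hx)

theorem FreeIn.not {ψ : Form V} {X : Set V} (hψ : ψ.FreeIn X) : ψ.not.FreeIn X := by
  obtain ⟨a, rfl, ha⟩ := hψ
  exact ⟨a.not, rfl, ha⟩

theorem FreeIn.bigOr {φ : V → Form V} {S X : Set V} (hS : S.Finite)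
    (h : ∀ x ∈ S, (φ x).FreeIn X) : (bigOr φ S).FreeIn X := by
  have : ∀ l : List V, (∀ x ∈ l, (φ x).FreeIn X) → ((l.map φ).foldr Form.or Form.fls).FreeIn X := by
    intro l hl
    induction l with
    | nil => exact ⟨FormExpr.fls, rfl, Set.empty_subset _⟩
    | cons a l ih =>
      obtain ⟨b, hb, hbX⟩ := hl a (by simp)
      obtain ⟨c, hc, hcX⟩ := ih fun x hx => hl x (by simp [hx])
      refine ⟨b.or c, ?_, Set.union_subset hbX hcX⟩
      rw [List.map_cons, List.foldr_cons, hb, hc]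
      rfl
  exact this _ fun x hx => h x ((mem_finList hS).1 hx)

theorem rename_not (f : V → W) (ψ : Form V) :
    ψ.not.rename f = (ψ.rename f).not :=
  ext_holds fun v => by simp

theorem FreeIn.rename_injective [Nonempty V] {ψ χ : Form V} {X : Set V}
    (hψ : ψ.FreeIn X) (hχ : χ.FreeIn X) {f : V → W} (hf : X.InjOn f)
    (h : ψ.rename f = χ.rename f) : ψ = χ :=
  ext_holds fun v =>
    ⟨(hψ.implies_rename hχ hf).1 (fun _ => (h ▸ id)) v,
      (hχ.implies_rename hψ hf).1 (fun _ => (h ▸ id)) v⟩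

end Form

/-! ### Embeddings onto prefixes -/

namespace PreLPO

variable {V L : Type*}

/-- `k` identifies the nodes of `α`, with their order, with a downward closed set of nodes of
`β`. -/
structure OrderEmb (k : V → V) (α β : PreLPO V L) : Prop where
  mapsTo : Set.MapsTo k α.N β.N
  injOn : Set.InjOn k α.N
  lt_iff : ∀ x ∈ α.N, ∀ y ∈ α.N, β.lt (k x) (k y) ↔ α.lt x y
  down : ∀ x ∈ α.N, ∀ y ∈ β.N, β.lt y (k x) → ∃ z ∈ α.N, k z = y

/-- `k` is an isomorphism between `α` and a tuple that is smaller than `β` in the sense of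
`LPO.Le`. The last clause replaces the condition on immediate successors. -/
structure Emb [LE L] [OrderBot L] (k : V → V) (α β : PreLPO V L) : Prop extends
    OrderEmb k α β where
  lab_le : ∀ x ∈ α.N, α.lab x ≤ β.lab (k x)
  form_eq : ∀ x ∈ α.N, β.form (k x) = (α.form x).rename k
  missing : ∀ y ∈ β.N, y ∉ k '' α.N → ∃ z ∈ α.bots, β.lt (k z) y

/-- `k` is an isomorphism from `α` to `β`. -/
structure IsoBy (k : V → V) (α β : PreLPO V L) : Prop where
  bijOn : Set.BijOn k α.N β.N
  lt_iff : ∀ x ∈ α.N, ∀ y ∈ α.N, β.lt (k x) (k y) ↔ α.lt x y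
  lab_eq : ∀ x ∈ α.N, β.lab (k x) = α.lab x
  form_eq : ∀ x ∈ α.N, β.form (k x) = (α.form x).rename k

theorem IsoBy.orderEmb {k : V → V} {α β : PreLPO V L} (h : IsoBy k α β) : OrderEmb k α β where
  mapsTo := h.bijOn.mapsTo
  injOn := h.bijOn.injOn
  lt_iff := h.lt_iff
  down := fun _ _ _ hy _ => h.bijOn.surjOn hy

theorem IsoBy.emb [Preorder L] [OrderBot L] {k : V → V} {α β : PreLPO V L} (h : IsoBy k α β) :
    Emb k α β where
  toOrderEmb := h.orderEmb
  lab_le := fun x hx => (h.lab_eq x hx).ge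
  form_eq := h.form_eq
  missing := fun _ hy hn => absurd (h.bijOn.surjOn hy) hn

theorem OrderEmb.mem_succ_iff {k : V → V} {α β : PreLPO V L} (h : OrderEmb k α β) {x y : V}
    (hx : x ∈ α.N) (hy : y ∈ α.N) : k y ∈ β.succ (k x) ↔ y ∈ α.succ x := by
  constructor
  · rintro ⟨⟨-, h1⟩, h2⟩
    refine ⟨⟨hy, (h.lt_iff _ hx _ hy).1 h1⟩, ?_⟩
    rintro ⟨z, hz, h3, h4⟩
    exact h2 ⟨k z, h.mapsTo hz, (h.lt_iff _ hx _ hz).2 h3, (h.lt_iff _ hz _ hy).2 h4⟩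
  · rintro ⟨⟨-, h1⟩, h2⟩
    refine ⟨⟨h.mapsTo hy, (h.lt_iff _ hx _ hy).2 h1⟩, ?_⟩
    rintro ⟨z, hz, h3, h4⟩
    obtain ⟨z, hz', rfl⟩ := h.down y hy z hz h4
    exact h2 ⟨z, hz', (h.lt_iff _ hx _ hz').1 h3, (h.lt_iff _ hz' _ hy).1 h4⟩

theorem mem_pred_iff {α : PreLPO V L} {x y : V} (hx : x ∈ α.N) (hy : y ∈ α.N) :
    x ∈ α.pred y ↔ y ∈ α.succ x :=
  ⟨fun h => ⟨⟨hy, h.1.2⟩, h.2⟩, fun h => ⟨⟨hx, h.1.2⟩, h.2⟩⟩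

theorem OrderEmb.mem_minNodes_iff {k : V → V} {α β : PreLPO V L} (h : OrderEmb k α β) {x : V}
    (hx : x ∈ α.N) : k x ∈ β.minNodes ↔ x ∈ α.minNodes := by
  refine ⟨fun hm => ⟨hx, Set.eq_empty_of_forall_notMem fun y hy => ?_⟩,
    fun hm => ⟨h.mapsTo hx, Set.eq_empty_of_forall_notMem fun y hy => ?_⟩⟩
  · have := (mem_pred_iff (h.mapsTo hy.1.1) (h.mapsTo hx)).2
      ((h.mem_succ_iff hy.1.1 hx).2 ((mem_pred_iff hy.1.1 hx).1 hy))
    rw [hm.2] at this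
    exact this
  · obtain ⟨z, hz, rfl⟩ := h.down x hx y hy.1.1 hy.1.2
    have := (mem_pred_iff hz hx).2
      ((h.mem_succ_iff hz hx).1 ((mem_pred_iff (h.mapsTo hz) (h.mapsTo hx)).1 hy))
    rw [hm.2] at this
    exact this

/-- The lengths of the chains of immediate successors from a minimal node to `x`. -/
def chainLengths (α : PreLPO V L) (x : V) : Set ℕ :=
  {n | ∃ c : ℕ → V, c 0 ∈ α.minNodes ∧ c n = x ∧ ∀ i < n, c (i + 1) ∈ α.succ (c i)}

theorem chain_mem {α : PreLPO V L} {c : ℕ → V} {n : ℕ} (h0 : c 0 ∈ α.minNodes)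
    (hc : ∀ i < n, c (i + 1) ∈ α.succ (c i)) {i : ℕ} (hi : i ≤ n) : c i ∈ α.N := by
  cases i with
  | zero => exact h0.1
  | succ i => exact (hc i hi).1.1

/-- Levels are preserved, because chains that end in a downward closed set stay in it. -/
theorem OrderEmb.lev_eq {k : V → V} {α β : PreLPO V L} (h : OrderEmb k α β) {x : V}
    (hx : x ∈ α.N) : β.lev (k x) = α.lev x := by
  suffices e : β.chainLengths (k x) = α.chainLengths x from congrArg sSup e
  ext n
  constructor
  · rintro ⟨c, h0, hn, hc⟩
    have hmem : ∀ j ≤ n, c (n - j) ∈ k '' α.N := by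
      intro j
      induction j with
      | zero => exact fun _ => ⟨x, hx, hn.symm⟩
      | succ j ih =>
        intro hj
        obtain ⟨y, hy, e⟩ := ih (by omega)
        have hs := hc (n - (j + 1)) (by omega)
        rw [show n - (j + 1) + 1 = n - j by omega, ← e] at hs
        exact h.down y hy _ (chain_mem h0 hc (by omega)) hs.1.2
    have hmem' : ∀ i ≤ n, ∃ y ∈ α.N, k y = c i := fun i hi => by
      have := hmem (n - i) (by omega)
      rwa [show n - (n - i) = i by omega] at this
    have : Nonempty V := ⟨x⟩
    choose! d hd hkd using hmem'
    refine ⟨d, ?_, ?_, fun i hi => ?_⟩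
    · rw [← h.mem_minNodes_iff (hd 0 (by omega)), hkd 0 (by omega)]
      exact h0
    · exact h.injOn (hd n le_rfl) hx ((hkd n le_rfl).trans hn)
    · rw [← h.mem_succ_iff (hd i hi.le) (hd (i + 1) hi), hkd i hi.le, hkd (i + 1) hi]
      exact hc i hi
  · rintro ⟨c, h0, hn, hc⟩
    refine ⟨k ∘ c, (h.mem_minNodes_iff h0.1).2 h0, congrArg k hn, fun i hi => ?_⟩
    exact (h.mem_succ_iff (chain_mem h0 hc hi.le) (chain_mem h0 hc hi)).2 (hc i hi)

theorem exists_le_pred {α : PreLPO V L} (hirr : ∀ x, ¬ α.lt x x)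
    (htr : ∀ x y z, α.lt x y → α.lt y z → α.lt x z) {x z : V} (hfin : (α.down x).Finite)
    (hz : z ∈ α.N) (hzx : α.lt z x) : ∃ w ∈ α.pred x, w = z ∨ α.lt z w := by
  let T : Set V := {w | w ∈ α.down x ∧ (w = z ∨ α.lt z w)}
  have hT : T.Finite := hfin.subset fun w hw => hw.1
  have hlt : IsStrictOrder V (Function.swap α.lt) :=
    { irrefl := hirr, trans := fun _ _ _ h1 h2 => htr _ _ _ h2 h1 }
  obtain ⟨w, -, hmax⟩ := (hT.wellFoundedOn (r := Function.swap α.lt)).has_min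
    (s := (Set.univ : Set T)) ⟨⟨z, ⟨hz, hzx⟩, Or.inl rfl⟩, trivial⟩
  refine ⟨w.1, ⟨w.2.1, ?_⟩, w.2.2⟩
  rintro ⟨u, hu, hwu, hux⟩
  refine hmax ⟨u, ⟨hu, hux⟩, Or.inr ?_⟩ trivial hwu
  rcases w.2.2 with e | e
  · exact e ▸ hwu
  · exact htr _ _ _ e hwu

/-- A criterion for `IsLPO` that puts the conditions on the root and on bottom nodes in terms of
the order instead of immediate successors. -/
theorem isLPO_of_root [LE L] [OrderBot L] {α : PreLPO V L}
    (lt_mem : ∀ x y, α.lt x y → x ∈ α.N ∧ y ∈ α.N)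
    (lab_out : ∀ x, x ∉ α.N → α.lab x = ⊥)
    (form_out : ∀ x, x ∉ α.N → α.form x = Form.tru)
    (countable : α.N.Countable)
    (irrefl : ∀ x, ¬ α.lt x x)
    (trans : ∀ x y z, α.lt x y → α.lt y z → α.lt x z)
    (finitely_preceded : ∀ x ∈ α.N, (α.down x).Finite)
    (finite_level : ∀ n : ℕ, {x | x ∈ α.N ∧ α.lev x = n}.Finite)
    (root : ∃ r ∈ α.N, ∀ x ∈ α.N, r = x ∨ α.lt r x)
    (lab_bot : ∀ x ∈ α.N, α.lab x = ⊥ → ∀ y, ¬ α.lt x y)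
    (sat : ∀ x ∈ α.N, (α.form x).Sat)
    (free : ∀ x ∈ α.N, (α.form x).FreeIn (α.down x))
    (form_mono : ∀ x y, α.lt x y → (α.form y).Implies (α.form x)) : α.IsLPO where
  lt_mem := lt_mem
  lab_out := lab_out
  form_out := form_out
  countable := countable
  irrefl := irrefl
  trans := trans
  finitely_preceded := finitely_preceded
  finite_level := finite_level
  rooted := by
    obtain ⟨r, hr, hle⟩ := root
    refine ⟨r, Set.eq_singleton_iff_unique_mem.2 ⟨⟨hr, ?_⟩, fun x hx => ?_⟩⟩
    · refine Set.eq_empty_of_forall_notMem fun y hy => ?_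
      rcases hle y hy.1.1 with e | e
      · exact irrefl r (by simpa [← e] using hy.1.2)
      · exact irrefl r (trans _ _ _ e hy.1.2)
    · rcases hle x hx.1 with e | e
      · exact e.symm
      · obtain ⟨w, hw, -⟩ := exists_le_pred irrefl trans (finitely_preceded x hx.1) hr e
        rw [hx.2] at hw
        exact hw.elim
  lab_bot := fun x hx h => Set.eq_empty_of_forall_notMem fun y hy => lab_bot x hx h y hy.1.2
  sat := sat
  free := free
  form_mono := form_mono

end PreLPO

/-! ### Levels -/

namespace LPO

open PreLPO

variable {V L : Type*} [LE L] [OrderBot L] (α : LPO V L)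

theorem free_nodes {x : V} (hx : x ∈ α.1.N) : (α.1.form x).FreeIn α.1.N :=
  (α.2.free x hx).mono fun _ h => h.1

theorem down_finite (x : V) : (α.1.down x).Finite := by
  by_cases hx : x ∈ α.1.N
  · exact α.2.finitely_preceded x hx
  · rw [Set.eq_empty_of_forall_notMem fun y (hy : y ∈ α.1.down x) => hx (α.2.lt_mem _ _ hy.2).2]
    exact Set.finite_empty

theorem lt_wf : WellFounded α.1.lt := by
  refine Subrelation.wf (r := InvImage (· < ·) fun x => (α.1.down x).ncard) ?_
    (InvImage.wf _ wellFounded_lt)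
  intro x y h
  refine Set.ncard_lt_ncard ⟨fun z hz => ⟨hz.1, α.2.trans _ _ _ hz.2 h⟩, fun hs => ?_⟩
    (α.down_finite y)
  exact α.2.irrefl x (hs ⟨(α.2.lt_mem _ _ h).1, h⟩).2

theorem chain_lt {c : ℕ → V} {n : ℕ} (hc : ∀ i < n, c (i + 1) ∈ α.1.succ (c i)) {i j : ℕ}
    (hij : i < j) (hj : j ≤ n) : α.1.lt (c i) (c j) := by
  induction j with
  | zero => omega
  | succ j ih =>
    have h1 := (hc j hj).1.2
    rcases Nat.lt_succ_iff_lt_or_eq.1 hij with h | rfl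
    · exact α.2.trans _ _ _ (ih h (by omega)) h1
    · exact h1

theorem chainLengths_bddAbove (x : V) : BddAbove (α.1.chainLengths x) := by
  refine ⟨(α.down_finite x).toFinset.card, ?_⟩
  rintro n ⟨c, h0, hn, hc⟩
  rw [← Finset.card_range n]
  refine Finset.card_le_card_of_injOn c (fun i hi => ?_) fun i hi j hj hij => ?_
  · have hi : i < n := by simpa using hi
    rw [Set.Finite.coe_toFinset]
    exact ⟨chain_mem h0 hc hi.le, hn ▸ α.chain_lt hc hi le_rfl⟩
  · have hi : i < n := by simpa using hi
    have hj : j < n := by simpa using hj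
    by_contra hne
    rcases lt_or_gt_of_ne hne with h | h
    · exact α.2.irrefl (c j) (by simpa [hij] using α.chain_lt hc h hj.le)
    · exact α.2.irrefl (c j) (by simpa [hij] using α.chain_lt hc h hi.le)

theorem succ_mem_chainLengths {x y : V} (hy : y ∈ α.1.succ x) {n : ℕ}
    (hn : n ∈ α.1.chainLengths x) : n + 1 ∈ α.1.chainLengths y := by
  obtain ⟨c, h0, hn, hc⟩ := hn
  refine ⟨fun i => if i ≤ n then c i else y, by simpa using h0, by simp, fun i hi => ?_⟩
  rcases Nat.lt_succ_iff_lt_or_eq.1 hi with h | rfl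
  · simpa [h.le, Nat.succ_le_of_lt h] using hc i h
  · simpa [hn] using hy

theorem chainLengths_nonempty {x : V} (hx : x ∈ α.1.N) : (α.1.chainLengths x).Nonempty := by
  induction x using α.lt_wf.induction with
  | _ x ih =>
    by_cases hm : x ∈ α.1.minNodes
    · exact ⟨0, fun _ => x, hm, rfl, fun i hi => by omega⟩
    · obtain ⟨y, hy⟩ : (α.1.pred x).Nonempty :=
        Set.nonempty_iff_ne_empty.2 fun h => hm ⟨hx, h⟩
      obtain ⟨n, hn⟩ := ih y hy.1.2 hy.1.1
      exact ⟨n + 1, α.succ_mem_chainLengths ((mem_pred_iff hy.1.1 hx).1 hy) hn⟩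

theorem lev_mem_chainLengths {x : V} (hx : x ∈ α.1.N) : α.1.lev x ∈ α.1.chainLengths x :=
  Nat.sSup_mem (α.chainLengths_nonempty hx) (α.chainLengths_bddAbove x)

theorem le_lev {x : V} {n : ℕ} (hn : n ∈ α.1.chainLengths x) : n ≤ α.1.lev x :=
  le_csSup (α.chainLengths_bddAbove x) hn

theorem lev_lt_of_succ {x y : V} (hx : x ∈ α.1.N) (hy : y ∈ α.1.succ x) :
    α.1.lev x < α.1.lev y :=
  α.le_lev (α.succ_mem_chainLengths hy (α.lev_mem_chainLengths hx))

theorem lev_lt {x y : V} (h : α.1.lt x y) : α.1.lev x < α.1.lev y := by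
  induction y using α.lt_wf.induction with
  | _ y ih =>
    obtain ⟨hx, hy⟩ := α.2.lt_mem _ _ h
    obtain ⟨w, hw, e⟩ := exists_le_pred α.2.irrefl α.2.trans (α.down_finite y) hx h
    have hwy := α.lev_lt_of_succ hw.1.1 ((mem_pred_iff hw.1.1 hy).1 hw)
    rcases e with rfl | e
    · exact hwy
    · exact (ih w hw.1.2 e).trans hwy

/-- Below a node there are nodes of all smaller levels. -/
theorem exists_lt_lev_eq {y : V} (hy : y ∈ α.1.N) {n : ℕ} (hn : n < α.1.lev y) :
    ∃ z, α.1.lt z y ∧ α.1.lev z = n := by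
  obtain ⟨c, h0, hm, hc⟩ := α.lev_mem_chainLengths hy
  refine ⟨c n, by simpa only [hm] using α.chain_lt hc hn le_rfl, le_antisymm ?_ ?_⟩
  · have hgrow : ∀ j, n + j ≤ α.1.lev y → α.1.lev (c n) + j ≤ α.1.lev (c (n + j)) := by
      intro j
      induction j with
      | zero => simp
      | succ j ih =>
        intro hj
        have h1 := ih (by omega)
        have h2 := α.lev_lt (hc (n + j) (by omega)).1.2
        rw [show n + (j + 1) = n + j + 1 from rfl]
        omega
    have := hgrow (α.1.lev y - n) (by omega)
    rw [show n + (α.1.lev y - n) = α.1.lev y by omega, hm] at this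
    omega
  · exact α.le_lev ⟨c, h0, rfl, fun i hi => hc i (by omega)⟩

theorem finite_lev_le (n : ℕ) : {x | x ∈ α.1.N ∧ α.1.lev x ≤ n}.Finite := by
  refine ((Set.finite_Iic n).biUnion fun i _ => α.2.finite_level i).subset ?_
  rintro x ⟨hx, hn⟩
  simp only [Set.mem_iUnion]
  exact ⟨α.1.lev x, hn, hx, rfl⟩

theorem finite_lev_lt (n : ℕ) : {x | x ∈ α.1.N ∧ α.1.lev x < n}.Finite :=
  (α.finite_lev_le n).subset fun _ hx => ⟨hx.1, hx.2.le⟩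

end LPO

/-! ### Transport along injections -/

namespace PreLPO

variable {V L : Type*}

theorem IsoBy.congr {k h : V → V} {α β : PreLPO V L} (H : IsoBy k α β)
    (hf : ∀ x ∈ α.N, (α.form x).FreeIn α.N) (e : ∀ x ∈ α.N, k x = h x) : IsoBy h α β where
  bijOn := H.bijOn.congr e
  lt_iff := fun x hx y hy => by rw [← e x hx, ← e y hy]; exact H.lt_iff x hx y hy
  lab_eq := fun x hx => by rw [← e x hx]; exact H.lab_eq x hx
  form_eq := fun x hx => by
    rw [← e x hx, H.form_eq x hx]
    exact (hf x hx).rename_congr e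

theorem IsoBy.trans {k h : V → V} {α β γ : PreLPO V L} (H : IsoBy k α β) (H' : IsoBy h β γ) :
    IsoBy (h ∘ k) α γ where
  bijOn := H'.bijOn.comp H.bijOn
  lt_iff := fun x hx y hy =>
    (H'.lt_iff _ (H.bijOn.mapsTo hx) _ (H.bijOn.mapsTo hy)).trans (H.lt_iff x hx y hy)
  lab_eq := fun x hx => (H'.lab_eq _ (H.bijOn.mapsTo hx)).trans (H.lab_eq x hx)
  form_eq := fun x hx => by
    rw [← Form.rename_rename, ← H.form_eq x hx]
    exact H'.form_eq _ (H.bijOn.mapsTo hx)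

theorem IsoBy.symm {k h : V → V} {α β : PreLPO V L} (H : IsoBy k α β)
    (hf : ∀ x ∈ α.N, (α.form x).FreeIn α.N) (e : ∀ x ∈ α.N, h (k x) = x) : IsoBy h β α where
  bijOn := by
    refine ⟨fun y hy => ?_, fun y hy z hz hyz => ?_, fun x hx => ⟨k x, H.bijOn.mapsTo hx, e x hx⟩⟩
    · obtain ⟨x, hx, rfl⟩ := H.bijOn.surjOn hy
      rwa [e x hx]
    · obtain ⟨x, hx, rfl⟩ := H.bijOn.surjOn hy
      obtain ⟨x', hx', rfl⟩ := H.bijOn.surjOn hz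
      rw [e x hx, e x' hx'] at hyz
      rw [hyz]
  lt_iff := fun y hy z hz => by
    obtain ⟨x, hx, rfl⟩ := H.bijOn.surjOn hy
    obtain ⟨x', hx', rfl⟩ := H.bijOn.surjOn hz
    rw [e x hx, e x' hx', H.lt_iff x hx x' hx']
  lab_eq := fun y hy => by
    obtain ⟨x, hx, rfl⟩ := H.bijOn.surjOn hy
    rw [e x hx, H.lab_eq x hx]
  form_eq := fun y hy => by
    obtain ⟨x, hx, rfl⟩ := H.bijOn.surjOn hy
    rw [e x hx, H.form_eq x hx, Form.rename_rename]
    exact ((hf x hx).rename_eq_self e).symm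

theorem IsoBy.isLPO [LE L] [OrderBot L] {k : V → V} {β : PreLPO V L} {α : LPO V L}
    (H : IsoBy k α.1 β)
    (lt_mem : ∀ x y, β.lt x y → x ∈ β.N ∧ y ∈ β.N)
    (lab_out : ∀ x, x ∉ β.N → β.lab x = ⊥)
    (form_out : ∀ x, x ∉ β.N → β.form x = Form.tru) : β.IsLPO := by
  have hN : ∀ {y}, y ∈ β.N → ∃ x ∈ α.1.N, k x = y := fun hy => H.bijOn.surjOn hy
  have hdown : ∀ x ∈ α.1.N, β.down (k x) = k '' α.1.down x := by
    intro x hx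
    ext y
    constructor
    · rintro ⟨hy, hyx⟩
      obtain ⟨z, hz, rfl⟩ := hN hy
      exact ⟨z, ⟨hz, (H.lt_iff z hz x hx).1 hyx⟩, rfl⟩
    · rintro ⟨z, ⟨hz, hzx⟩, rfl⟩
      exact ⟨H.bijOn.mapsTo hz, (H.lt_iff z hz x hx).2 hzx⟩
  have hlt : ∀ {y z}, β.lt y z → ∃ a ∈ α.1.N, ∃ b ∈ α.1.N, k a = y ∧ k b = z ∧ α.1.lt a b := by
    intro y z hyz
    obtain ⟨hy, hz⟩ := lt_mem _ _ hyz
    obtain ⟨a, ha, rfl⟩ := hN hy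
    obtain ⟨b, hb, rfl⟩ := hN hz
    exact ⟨a, ha, b, hb, rfl, rfl, (H.lt_iff a ha b hb).1 hyz⟩
  refine isLPO_of_root lt_mem lab_out form_out ?_ ?_ ?_ ?_ ?_ ?_ ?_ ?_ ?_ ?_
  · rw [← H.bijOn.image_eq]
    exact α.2.countable.image k
  · intro y hy
    obtain ⟨a, ha, b, hb, rfl, e, hab⟩ := hlt hy
    rw [H.bijOn.injOn hb ha e] at hab
    exact α.2.irrefl a hab
  · intro x y z hxy hyz
    obtain ⟨a, ha, b, hb, rfl, rfl, hab⟩ := hlt hxy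
    obtain ⟨b', hb', c, hc, e, rfl, hbc⟩ := hlt hyz
    rw [H.bijOn.injOn hb' hb e] at hbc
    exact (H.lt_iff a ha c hc).2 (α.2.trans _ _ _ hab hbc)
  · intro y hy
    obtain ⟨x, hx, rfl⟩ := hN hy
    rw [hdown x hx]
    exact (α.2.finitely_preceded x hx).image k
  · intro n
    refine ((α.2.finite_level n).image k).subset ?_
    rintro y ⟨hy, hn⟩
    obtain ⟨x, hx, rfl⟩ := hN hy
    exact ⟨x, ⟨hx, by rw [← hn, H.orderEmb.lev_eq hx]⟩, rfl⟩
  · obtain ⟨r, hr, hle⟩ := α.exists_root_le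
    refine ⟨k r, H.bijOn.mapsTo hr, fun y hy => ?_⟩
    obtain ⟨x, hx, rfl⟩ := hN hy
    exact (hle x hx).imp (congrArg k) (H.lt_iff r hr x hx).2
  · intro y hy hb z hz
    obtain ⟨a, ha, b, -, rfl, rfl, hab⟩ := hlt hz
    rw [H.lab_eq a ha] at hb
    exact α.not_lt_of_bot ⟨ha, hb⟩ hab
  · intro y hy
    obtain ⟨x, hx, rfl⟩ := hN hy
    have : Nonempty V := ⟨x⟩
    rw [H.form_eq x hx, (α.free_nodes hx).sat_rename H.bijOn.injOn]
    exact α.2.sat x hx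
  · intro y hy
    obtain ⟨x, hx, rfl⟩ := hN hy
    rw [H.form_eq x hx, hdown x hx]
    exact (α.2.free x hx).rename k
  · intro y z hyz
    obtain ⟨a, ha, b, hb, rfl, rfl, hab⟩ := hlt hyz
    have : Nonempty V := ⟨a⟩
    rw [H.form_eq a ha, H.form_eq b hb,
      (α.free_nodes hb).implies_rename (α.free_nodes ha) H.bijOn.injOn]
    exact α.2.form_mono a b hab

open Classical in
/-- The image of `α` under a map `k` that is injective on its nodes. -/
noncomputable def map [LE L] [OrderBot L] (α : PreLPO V L) (k : V → V) : PreLPO V L where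
  N := k '' α.N
  lt x y := ∃ a ∈ α.N, ∃ b ∈ α.N, α.lt a b ∧ k a = x ∧ k b = y
  lab x := if h : ∃ a ∈ α.N, k a = x then α.lab h.choose else ⊥
  form x := if h : ∃ a ∈ α.N, k a = x then (α.form h.choose).rename k else Form.tru

theorem isoBy_map [LE L] [OrderBot L] (α : PreLPO V L) {k : V → V} (hk : α.N.InjOn k) :
    IsoBy k α (α.map k) := by
  have hch : ∀ x ∈ α.N, ∃ h : ∃ a ∈ α.N, k a = k x, h.choose = x := fun x hx =>
    ⟨⟨x, hx, rfl⟩, hk (Exists.choose_spec (⟨x, hx, rfl⟩ : ∃ a ∈ α.N, k a = k x)).1 hx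
      (Exists.choose_spec (⟨x, hx, rfl⟩ : ∃ a ∈ α.N, k a = k x)).2⟩
  refine ⟨hk.bijOn_image, fun x hx y hy => ⟨?_, fun h => ⟨x, hx, y, hy, h, rfl, rfl⟩⟩,
    fun x hx => ?_, fun x hx => ?_⟩
  · rintro ⟨a, ha, b, hb, hab, e1, e2⟩
    rwa [hk ha hx e1, hk hb hy e2] at hab
  · obtain ⟨h, e⟩ := hch x hx
    simp only [map]
    rw [dif_pos h, e]
  · obtain ⟨h, e⟩ := hch x hx
    simp only [map]
    rw [dif_pos h, e]

end PreLPO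

namespace LPO

open PreLPO

variable {V L : Type*}

/-- The image of `α` under a map `k` that is injective on its nodes. -/
noncomputable def map [LE L] [OrderBot L] (α : LPO V L) (k : V → V) (hk : α.1.N.InjOn k) :
    LPO V L :=
  ⟨α.1.map k, (α.1.isoBy_map hk).isLPO
    (by rintro x y ⟨a, ha, b, hb, -, rfl, rfl⟩; exact ⟨⟨a, ha, rfl⟩, ⟨b, hb, rfl⟩⟩)
    (fun x hx => dif_neg fun ⟨a, ha, e⟩ => hx ⟨a, ha, e⟩)
    (fun x hx => dif_neg fun ⟨a, ha, e⟩ => hx ⟨a, ha, e⟩)⟩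

theorem isoBy_map [LE L] [OrderBot L] (α : LPO V L) {k : V → V} (hk : α.1.N.InjOn k) :
    IsoBy k α.1 (α.map k hk).1 := α.1.isoBy_map hk

theorem iso_iff [LE L] [OrderBot L] {α β : LPO V L} : Iso α β ↔ ∃ k, IsoBy k α.1 β.1 :=
  ⟨fun ⟨k, h1, h2, h3, h4⟩ => ⟨k, h1, h2, h3, h4⟩,
    fun ⟨k, h⟩ => ⟨k, h.bijOn, h.lt_iff, h.lab_eq, h.form_eq⟩⟩

theorem isoBy_id [LE L] [OrderBot L] (α : LPO V L) : IsoBy id α.1 α.1 where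
  bijOn := Set.bijOn_id _
  lt_iff := fun _ _ _ _ => Iff.rfl
  lab_eq := fun _ _ => rfl
  form_eq := fun _ hx => ((α.free_nodes hx).rename_eq_self fun _ _ => rfl).symm

theorem exists_isoBy_symm [LE L] [OrderBot L] {α : LPO V L} {β : PreLPO V L} {k : V → V}
    (h : IsoBy k α.1 β) : ∃ g : V → V, IsoBy g β α.1 ∧ ∀ x ∈ α.1.N, g (k x) = x := by
  obtain ⟨r, hr, -⟩ := α.exists_root_le
  have : Nonempty V := ⟨r⟩
  have e := h.bijOn.injOn.leftInvOn_invFunOn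
  exact ⟨_, h.symm (fun x hx => α.free_nodes hx) e, e⟩

theorem Iso.refl [LE L] [OrderBot L] (α : LPO V L) : Iso α α := iso_iff.2 ⟨_, α.isoBy_id⟩

theorem Iso.symm [LE L] [OrderBot L] {α β : LPO V L} (h : Iso α β) : Iso β α :=
  let ⟨_, hk⟩ := iso_iff.1 h
  let ⟨g, hg, _⟩ := exists_isoBy_symm hk
  iso_iff.2 ⟨g, hg⟩

theorem Iso.trans [LE L] [OrderBot L] {α β γ : LPO V L} (h : Iso α β) (h' : Iso β γ) :
    Iso α γ :=
  let ⟨_, hk⟩ := iso_iff.1 h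
  let ⟨_, hk'⟩ := iso_iff.1 h'
  iso_iff.2 ⟨_, hk.trans hk'⟩

/-- Two images under the same map are equal. -/
theorem eq_of_isoBy [LE L] [OrderBot L] {α : PreLPO V L} {β γ : LPO V L} {k : V → V}
    (h : IsoBy k α β.1) (h' : IsoBy k α γ.1) : β = γ := by
  have hN : β.1.N = γ.1.N := h.bijOn.image_eq.symm.trans h'.bijOn.image_eq
  refine Subtype.ext (PreLPO.ext hN ?_ ?_ ?_)
  · ext x y
    constructor
    · intro hxy
      obtain ⟨hx, hy⟩ := β.2.lt_mem _ _ hxy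
      obtain ⟨a, ha, rfl⟩ := h.bijOn.surjOn hx
      obtain ⟨b, hb, rfl⟩ := h.bijOn.surjOn hy
      exact (h'.lt_iff a ha b hb).2 ((h.lt_iff a ha b hb).1 hxy)
    · intro hxy
      obtain ⟨hx, hy⟩ := γ.2.lt_mem _ _ hxy
      obtain ⟨a, ha, rfl⟩ := h'.bijOn.surjOn hx
      obtain ⟨b, hb, rfl⟩ := h'.bijOn.surjOn hy
      exact (h.lt_iff a ha b hb).2 ((h'.lt_iff a ha b hb).1 hxy)
  · ext x
    by_cases hx : x ∈ β.1.N
    · obtain ⟨a, ha, rfl⟩ := h.bijOn.surjOn hx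
      rw [h.lab_eq a ha, h'.lab_eq a ha]
    · rw [β.2.lab_out x hx, γ.2.lab_out x (hN ▸ hx)]
  · ext x
    by_cases hx : x ∈ β.1.N
    · obtain ⟨a, ha, rfl⟩ := h.bijOn.surjOn hx
      rw [h.form_eq a ha, h'.form_eq a ha]
    · rw [β.2.form_out x hx, γ.2.form_out x (hN ▸ hx)]

variable [PartialOrder L] [OrderBot L]

theorem Emb.congr {k h : V → V} {α : LPO V L} {β : PreLPO V L} (H : Emb k α.1 β)
    (e : ∀ x ∈ α.1.N, k x = h x) : Emb h α.1 β where
  mapsTo := H.mapsTo.congr e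
  injOn := H.injOn.congr e
  lt_iff := fun x hx y hy => by rw [← e x hx, ← e y hy]; exact H.lt_iff x hx y hy
  down := fun x hx y hy hyx => by
    obtain ⟨z, hz, rfl⟩ := H.down x hx y hy (by rwa [e x hx])
    exact ⟨z, hz, (e z hz).symm⟩
  lab_le := fun x hx => by rw [← e x hx]; exact H.lab_le x hx
  form_eq := fun x hx => by
    rw [← e x hx, H.form_eq x hx]
    exact (α.free_nodes hx).rename_congr e
  missing := fun y hy hn => by
    rw [← Set.EqOn.image_eq e] at hn
    obtain ⟨z, hz, hzy⟩ := H.missing y hy hn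
    exact ⟨z, hz, by rwa [← e z hz.1]⟩

theorem Emb.comp {k h : V → V} {α β : PreLPO V L} {γ : LPO V L} (H : Emb k α β)
    (H' : Emb h β γ.1) : Emb (h ∘ k) α γ.1 where
  mapsTo := H'.mapsTo.comp H.mapsTo
  injOn := H'.injOn.comp H.injOn H.mapsTo
  lt_iff := fun x hx y hy =>
    (H'.lt_iff _ (H.mapsTo hx) _ (H.mapsTo hy)).trans (H.lt_iff x hx y hy)
  down := fun x hx y hy hyx => by
    obtain ⟨z, hz, rfl⟩ := H'.down _ (H.mapsTo hx) y hy hyx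
    obtain ⟨w, hw, rfl⟩ := H.down x hx z hz ((H'.lt_iff _ hz _ (H.mapsTo hx)).1 hyx)
    exact ⟨w, hw, rfl⟩
  lab_le := fun x hx => (H.lab_le x hx).trans (H'.lab_le _ (H.mapsTo hx))
  form_eq := fun x hx => by
    rw [← Form.rename_rename, ← H.form_eq x hx]
    exact H'.form_eq _ (H.mapsTo hx)
  missing := fun y hy hn => by
    by_cases hy' : y ∈ h '' β.N
    · obtain ⟨w, hw, rfl⟩ := hy'
      obtain ⟨z, hz, hzw⟩ := H.missing w hw fun ⟨x, hx, e⟩ => hn ⟨x, hx, congrArg h e⟩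
      exact ⟨z, hz, (H'.lt_iff _ (H.mapsTo hz.1) _ hw).2 hzw⟩
    · obtain ⟨z, hz, hzy⟩ := H'.missing y hy hy'
      by_cases hz' : z ∈ k '' α.N
      · obtain ⟨x, hx, rfl⟩ := hz'
        exact ⟨x, ⟨hx, le_bot_iff.1 ((H.lab_le x hx).trans hz.2.le)⟩, hzy⟩
      · obtain ⟨u, hu, huz⟩ := H.missing z hz.1 hz'
        exact ⟨u, hu, γ.2.trans _ _ _ ((H'.lt_iff _ (H.mapsTo hu.1) _ hz.1).2 huz) hzy⟩

theorem Emb.le {k : V → V} {α β : LPO V L} (H : Emb k α.1 β.1) (e : ∀ x ∈ α.1.N, k x = x) :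
    Le α β := by
  replace H : Emb id α.1 β.1 := Emb.congr H e
  have hlt : ∀ x y, α.1.lt x y ↔ β.1.lt x y ∧ x ∈ α.1.N ∧ y ∈ α.1.N := fun x y =>
    ⟨fun h => ⟨(H.lt_iff x (α.2.lt_mem x y h).1 y (α.2.lt_mem x y h).2).2 h, α.2.lt_mem x y h⟩,
      fun h => (H.lt_iff x h.2.1 y h.2.2).1 h.1⟩
  refine ⟨H.mapsTo, fun x hx y hy => ?_, hlt, H.lab_le, fun x hx => ?_, fun x hx => ?_⟩
  · obtain ⟨z, hz, rfl⟩ := H.down x hx y hy.1 hy.2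
    exact hz
  · exact ((H.form_eq x hx).trans ((α.free_nodes hx).rename_eq_self fun _ _ => rfl)).symm
  · ext y
    constructor
    · intro hy
      refine ⟨(H.mem_succ_iff hx hy.1.1).2 hy, ?_⟩
      rintro ⟨z, hz, -, hzy⟩
      exact α.not_lt_of_bot hz ((H.lt_iff z hz.1 y hy.1.1).1 hzy)
    · rintro ⟨hy, hn⟩
      have hyα : y ∈ α.1.N := by
        by_contra hc
        obtain ⟨z, hz, hzy⟩ := H.missing y hy.1.1 (by simpa using hc)
        exact hn ⟨z, hz, hy.1.1, hzy⟩
      exact (H.mem_succ_iff hx hyα).1 hy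

theorem Le.emb {α β : LPO V L} (h : Le α β) : Emb id α.1 β.1 where
  mapsTo := h.subset
  injOn := Set.injOn_id _
  lt_iff := fun x hx y hy =>
    ⟨fun k => (h.lt_iff x y).2 ⟨k, hx, hy⟩, fun k => ((h.lt_iff x y).1 k).1⟩
  down := fun x hx y hy k => ⟨y, h.down_closed x hx ⟨hy, k⟩, rfl⟩
  lab_le := h.lab_le
  form_eq := fun x hx =>
    (h.form_eq x hx).symm.trans ((α.free_nodes hx).rename_eq_self fun _ _ => rfl).symm
  missing := fun y hy hn => by
    obtain ⟨z, hz, -, hzy⟩ := h.missing hy (by simpa using hn)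
    exact ⟨z, hz, hzy⟩

theorem Le.lev_eq {α β : LPO V L} (h : Le α β) {x : V} (hx : x ∈ α.1.N) :
    β.1.lev x = α.1.lev x := h.emb.lev_eq hx

/-- A criterion for `Le` in which immediate successors do not occur. -/
theorem le_of_missing {α β : LPO V L} (subset : α.1.N ⊆ β.1.N)
    (down : ∀ x ∈ α.1.N, ∀ y, β.1.lt y x → y ∈ α.1.N)
    (lt_iff : ∀ x ∈ α.1.N, ∀ y ∈ α.1.N, β.1.lt x y ↔ α.1.lt x y)
    (lab_le : ∀ x ∈ α.1.N, α.1.lab x ≤ β.1.lab x)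
    (form_eq : ∀ x ∈ α.1.N, α.1.form x = β.1.form x)
    (missing : ∀ y ∈ β.1.N, y ∉ α.1.N → ∃ z ∈ α.1.bots, β.1.lt z y) : Le α β :=
  Emb.le (k := id)
    { mapsTo := subset
      injOn := Set.injOn_id _
      lt_iff := lt_iff
      down := fun x hx y _ h => ⟨y, down x hx y h, rfl⟩
      lab_le := lab_le
      form_eq := fun x hx =>
        (form_eq x hx).symm.trans ((α.free_nodes hx).rename_eq_self fun _ _ => rfl).symm
      missing := fun y hy hn => missing y hy (by simpa using hn) }
    fun _ _ => rfl

/-- Prefixes of the same `γ` are compared by comparing their nodes and labels. -/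
theorem Le.of_le {α β γ : LPO V L} (h : Le α γ) (h' : Le β γ) (hN : α.1.N ⊆ β.1.N)
    (hlab : ∀ x ∈ α.1.N, α.1.lab x ≤ β.1.lab x) : Le α β := by
  refine le_of_missing hN (fun x hx y hyx => ?_) (fun x hx y hy => ?_) hlab (fun x hx => ?_)
    fun y hy hn => ?_
  · have := (h'.lt_iff y x).1 hyx
    exact h.down_closed x hx ⟨h'.subset this.2.1, this.1⟩
  · rw [h.lt_iff, h'.lt_iff]
    exact ⟨fun k => ⟨k.1, hx, hy⟩, fun k => ⟨k.1, hN hx, hN hy⟩⟩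
  · rw [h.form_eq x hx, h'.form_eq x (hN hx)]
  · obtain ⟨z, hz, -, hzy⟩ := h.missing (h'.subset hy) hn
    exact ⟨z, hz, (h'.lt_iff z y).2 ⟨hzy, hN hz.1, hy⟩⟩

end LPO

/-! ### The order on pomsets -/

section Classes

open PreLPO LPO

variable {V L : Type*}

/-- The isomorphism class of `α`. -/
def cls [LE L] [OrderBot L] (α : LPO V L) : Pom V L := ⟨{β | Iso α β}, α, rfl⟩

theorem cls_eq_of_iso [LE L] [OrderBot L] {α β : LPO V L} (h : Iso α β) : cls α = cls β :=
  Subtype.ext (Set.ext fun _ => ⟨fun k => h.symm.trans k, fun k => h.trans k⟩)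

theorem eq_cls_of_mem [LE L] [OrderBot L] {A : Pom V L} {α : LPO V L} (h : α ∈ A.1) :
    A = cls α := by
  obtain ⟨β, hβ⟩ := A.2
  have : A = cls β := Subtype.ext hβ
  rw [this]
  exact cls_eq_of_iso (by rwa [this] at h)

theorem Pom.exists_mem [LE L] [OrderBot L] (A : Pom V L) : ∃ α, α ∈ A.1 := by
  obtain ⟨β, hβ⟩ := A.2
  exact ⟨β, by rw [hβ]; exact Iso.refl β⟩

theorem Pom.exists_eq_cls [LE L] [OrderBot L] (A : Pom V L) : ∃ α, A = cls α :=
  let ⟨α, h⟩ := A.exists_mem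
  ⟨α, eq_cls_of_mem h⟩

/-- Finiteness does not depend on the representative. -/
theorem finite_of_mem_cls [LE L] [OrderBot L] {α β : LPO V L} (hα : α.1.N.Finite)
    (h : β ∈ (cls α).1) : β.1.N.Finite := by
  obtain ⟨k, hk⟩ := iso_iff.1 h
  rw [← hk.bijOn.image_eq]
  exact hα.image k

variable [PartialOrder L] [OrderBot L]

theorem cls_le_iff {α β : LPO V L} : cls α ≤ cls β ↔ ∃ k, Emb k α.1 β.1 := by
  constructor
  · intro h
    obtain ⟨α', hα', hle⟩ := h β (Iso.refl β)
    obtain ⟨k, hk⟩ := iso_iff.1 hα'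
    exact ⟨_, Emb.comp hk.emb hle.emb⟩
  · rintro ⟨k, hk⟩ β' hβ'
    obtain ⟨h, hh⟩ := iso_iff.1 hβ'
    have H := Emb.comp hk hh.emb
    have hm := α.isoBy_map H.injOn
    obtain ⟨g, hg, e⟩ := exists_isoBy_symm hm
    refine ⟨_, iso_iff.2 ⟨_, hm⟩, Emb.le (Emb.comp hg.emb H) fun y hy => ?_⟩
    obtain ⟨x, hx, rfl⟩ := hm.bijOn.surjOn hy
    exact congrArg _ (e x hx)

theorem cls_le_of_le {α β : LPO V L} (h : Le α β) : cls α ≤ cls β :=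
  cls_le_iff.2 ⟨_, h.emb⟩

end Classes

/-! ### Finite approximation -/

namespace LPO

open PreLPO

variable {V L : Type*}

open Classical in
/-- The nodes of level at most `n`, with the label `⊥` at level `n`. The relabelling makes every
removed node a node above a bottom node, as `LPO.Le` requires. -/
noncomputable def preTrunc [LE L] [OrderBot L] (α : LPO V L) (n : ℕ) : PreLPO V L where
  N := {x | x ∈ α.1.N ∧ α.1.lev x ≤ n}
  lt x y := α.1.lt x y ∧ α.1.lev y ≤ n
  lab x := if x ∈ α.1.N ∧ α.1.lev x < n then α.1.lab x else ⊥
  form x := if x ∈ α.1.N ∧ α.1.lev x ≤ n then α.1.form x else Form.tru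

theorem lev_root [LE L] [OrderBot L] (α : LPO V L) {r : V} (hr : r ∈ α.1.N)
    (hle : ∀ x ∈ α.1.N, r = x ∨ α.1.lt r x) : α.1.lev r = 0 := by
  by_contra h
  obtain ⟨z, hz, -⟩ := α.exists_lt_lev_eq hr (Nat.pos_of_ne_zero h)
  rcases hle z (α.2.lt_mem _ _ hz).1 with e | e
  · exact α.2.irrefl r (by simpa [← e] using hz)
  · exact α.2.irrefl r (α.2.trans _ _ _ e hz)

theorem preTrunc_lab [LE L] [OrderBot L] (α : LPO V L) {n : ℕ} {x : V} (hx : x ∈ α.1.N)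
    (hn : α.1.lev x < n) : (α.preTrunc n).lab x = α.1.lab x := if_pos ⟨hx, hn⟩

theorem preTrunc_form [LE L] [OrderBot L] (α : LPO V L) {n : ℕ} {x : V} (hx : x ∈ α.1.N)
    (hn : α.1.lev x ≤ n) : (α.preTrunc n).form x = α.1.form x := if_pos ⟨hx, hn⟩

theorem isLPO_preTrunc [LE L] [OrderBot L] (α : LPO V L) (n : ℕ) : (α.preTrunc n).IsLPO := by
  have hfin : (α.preTrunc n).N.Finite := α.finite_lev_le n
  refine isLPO_of_root ?_ ?_ ?_ hfin.countable ?_ ?_ ?_ ?_ ?_ ?_ ?_ ?_ ?_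
  · rintro x y ⟨h, hy⟩
    exact ⟨⟨(α.2.lt_mem _ _ h).1, (α.lev_lt h).le.trans hy⟩, (α.2.lt_mem _ _ h).2, hy⟩
  · exact fun x hx => if_neg fun h => hx ⟨h.1, h.2.le⟩
  · exact fun x hx => if_neg hx
  · exact fun x h => α.2.irrefl x h.1
  · exact fun x y z h h' => ⟨α.2.trans _ _ _ h.1 h'.1, h'.2⟩
  · exact fun x _ => hfin.subset fun y hy => hy.1
  · exact fun n => hfin.subset fun y hy => hy.1
  · obtain ⟨r, hr, hle⟩ := α.exists_root_le
    refine ⟨r, ⟨hr, by simp [α.lev_root hr hle]⟩, fun x hx => ?_⟩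
    exact (hle x hx.1).imp id fun h => ⟨h, hx.2⟩
  · rintro x hx hb y ⟨hxy, hy⟩
    have hlt := (α.lev_lt hxy).trans_le hy
    rw [α.preTrunc_lab hx.1 hlt] at hb
    exact α.not_lt_of_bot ⟨hx.1, hb⟩ hxy
  · rintro x hx
    rw [α.preTrunc_form hx.1 hx.2]
    exact α.2.sat x hx.1
  · rintro x hx
    have hd : (α.preTrunc n).down x = α.1.down x := by
      ext y
      exact ⟨fun h => ⟨h.1.1, h.2.1⟩, fun h => ⟨⟨h.1, (α.lev_lt h.2).le.trans hx.2⟩, h.2, hx.2⟩⟩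
    rw [hd, α.preTrunc_form hx.1 hx.2]
    exact α.2.free x hx.1
  · rintro x y ⟨h, hy⟩
    rw [α.preTrunc_form (α.2.lt_mem _ _ h).1 ((α.lev_lt h).le.trans hy),
      α.preTrunc_form (α.2.lt_mem _ _ h).2 hy]
    exact α.2.form_mono _ _ h

/-- The finite approximation of `α` by its nodes of level at most `n`. -/
noncomputable def trunc [LE L] [OrderBot L] (α : LPO V L) (n : ℕ) : LPO V L :=
  ⟨α.preTrunc n, α.isLPO_preTrunc n⟩

theorem trunc_finite [LE L] [OrderBot L] (α : LPO V L) (n : ℕ) : (α.trunc n).1.N.Finite :=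
  α.finite_lev_le n

theorem trunc_lab [LE L] [OrderBot L] (α : LPO V L) {n : ℕ} {x : V} (hx : x ∈ α.1.N)
    (hn : α.1.lev x < n) : (α.trunc n).1.lab x = α.1.lab x := α.preTrunc_lab hx hn

theorem trunc_form [LE L] [OrderBot L] (α : LPO V L) {n : ℕ} {x : V}
    (hx : x ∈ (α.trunc n).1.N) :
    (α.trunc n).1.form x = α.1.form x := α.preTrunc_form hx.1 hx.2

variable [PartialOrder L] [OrderBot L]

theorem trunc_le (α : LPO V L) (n : ℕ) : Le (α.trunc n) α := by
  refine le_of_missing (fun x hx => hx.1) (fun x hx y hyx => ?_) (fun x _ y hy => ?_)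
    (fun x hx => ?_) (fun x hx => α.trunc_form hx) fun y hy hn => ?_
  · exact ⟨(α.2.lt_mem _ _ hyx).1, (α.lev_lt hyx).le.trans hx.2⟩
  · exact ⟨fun h => ⟨h, hy.2⟩, fun h => h.1⟩
  · by_cases h : α.1.lev x < n
    · exact (α.trunc_lab hx.1 h).le
    · exact (if_neg fun h' => h h'.2 : (α.trunc n).1.lab x = ⊥).le.trans bot_le
  · have hlt : n < α.1.lev y := not_le.1 fun h => hn ⟨hy, h⟩
    obtain ⟨z, hzy, hz⟩ := α.exists_lt_lev_eq hy hlt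
    exact ⟨z, ⟨⟨(α.2.lt_mem _ _ hzy).1, hz.le⟩, if_neg fun h => h.2.ne hz⟩, hzy⟩

theorem Le.le_trunc {φ α : LPO V L} (h : Le φ α) {n : ℕ} (hn : ∀ x ∈ φ.1.N, φ.1.lev x < n) :
    Le φ (α.trunc n) := by
  refine h.of_le (α.trunc_le n) (fun x hx => ⟨h.subset hx, ?_⟩) fun x hx => ?_
  · rw [h.lev_eq hx]
    exact (hn x hx).le
  · rw [α.trunc_lab (h.subset hx) (by rw [h.lev_eq hx]; exact hn x hx)]
    exact h.lab_le x hx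

theorem exists_lev_lt_of_finite {φ : LPO V L} (hφ : φ.1.N.Finite) :
    ∃ n, ∀ x ∈ φ.1.N, φ.1.lev x < n := by
  obtain ⟨m, hm⟩ := (hφ.image φ.1.lev).bddAbove
  exact ⟨m + 1, fun x hx => Nat.lt_succ_of_le (hm ⟨x, hx, rfl⟩)⟩

theorem exists_le_trunc {φ α : LPO V L} (h : Le φ α) (hφ : φ.1.N.Finite) :
    ∃ n, ∀ m, n ≤ m → Le φ (α.trunc m) :=
  let ⟨n, hn⟩ := exists_lev_lt_of_finite hφ
  ⟨n, fun _ hm => h.le_trunc fun x hx => (hn x hx).trans_le hm⟩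

/-- Compactness: as levels are finite, embeddings of all the finite approximations of `α` have a
limit along an ultrafilter, and this limit embeds `α`. -/
theorem exists_emb_of_trunc {α β : LPO V L} (h : ∀ n, ∃ k, Emb k (α.trunc n).1 β.1) :
    ∃ k, Emb k α.1 β.1 := by
  choose k hk using h
  let U : Ultrafilter ℕ := Filter.hyperfilter ℕ
  have hU : ∀ m, ∀ᶠ n in (U : Filter ℕ), m ≤ n := fun m =>
    Nat.hyperfilter_le_atTop (Filter.eventually_ge_atTop m)
  have hmem : ∀ x ∈ α.1.N, ∀ᶠ n in (U : Filter ℕ), x ∈ (α.trunc n).1.N := fun x hx =>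
    (hU (α.1.lev x)).mono fun n hn => ⟨hx, hn⟩
  have hlev : ∀ n, ∀ x ∈ (α.trunc n).1.N, β.1.lev (k n x) = α.1.lev x := fun n x hx =>
    ((hk n).lev_eq hx).trans ((α.trunc_le n).lev_eq hx).symm
  have hlim : ∀ x ∈ α.1.N, ∃ y, ∀ᶠ n in (U : Filter ℕ), k n x = y := by
    intro x hx
    have : ∀ᶠ n in (U : Filter ℕ), ∃ y ∈ {y | y ∈ β.1.N ∧ β.1.lev y ≤ α.1.lev x}, k n x = y := by
      filter_upwards [hmem x hx] with n hn
      exact ⟨_, ⟨(hk n).mapsTo hn, (hlev n x hn).le⟩, rfl⟩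
    obtain ⟨y, -, hy⟩ := (Ultrafilter.eventually_exists_mem_iff (β.finite_lev_le _)).1 this
    exact ⟨y, hy⟩
  obtain ⟨r, hr, -⟩ := α.exists_root_le
  have : Nonempty V := ⟨r⟩
  choose! g hg using hlim
  have hlt : ∀ x ∈ α.1.N, ∀ y ∈ α.1.N, β.1.lt (g x) (g y) ↔ α.1.lt x y := by
    intro x hx y hy
    obtain ⟨n, h1, h2, h3, h4⟩ :=
      ((hmem x hx).and ((hmem y hy).and ((hg x hx).and (hg y hy)))).exists
    rw [← h3, ← h4, (hk n).lt_iff x h1 y h2]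
    exact ⟨fun h => h.1, fun h => ⟨h, h2.2⟩⟩
  refine ⟨g, ⟨⟨fun x hx => ?_, fun x hx y hy hxy => ?_, hlt, fun x hx y hy hyx => ?_⟩,
    fun x hx => ?_, fun x hx => ?_, fun y hy hn => ?_⟩⟩
  · obtain ⟨n, h1, h2⟩ := ((hmem x hx).and (hg x hx)).exists
    rw [← h2]
    exact (hk n).mapsTo h1
  · obtain ⟨n, h1, h2, h3, h4⟩ :=
      ((hmem x hx).and ((hmem y hy).and ((hg x hx).and (hg y hy)))).exists
    exact (hk n).injOn h1 h2 (by rw [h3, h4, hxy])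
  · have : ∀ᶠ n in (U : Filter ℕ), ∃ z ∈ α.1.down x, k n z = y := by
      filter_upwards [hmem x hx, hg x hx] with n h1 h2
      rw [← h2] at hyx
      obtain ⟨z, hz, rfl⟩ := (hk n).down x h1 y hy hyx
      exact ⟨z, ⟨hz.1, (((hk n).lt_iff z hz x h1).1 hyx).1⟩, rfl⟩
    obtain ⟨z, hz, he⟩ := (Ultrafilter.eventually_exists_mem_iff (α.down_finite x)).1 this
    obtain ⟨n, h1, h2⟩ := (he.and (hg z hz.1)).exists
    exact ⟨z, hz.1, h2.symm.trans h1⟩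
  · obtain ⟨n, h1, h2, h3⟩ := ((hmem x hx).and ((hg x hx).and (hU (α.1.lev x + 1)))).exists
    rw [← h2, ← α.trunc_lab hx h3]
    exact (hk n).lab_le x h1
  · have : ∀ᶠ n in (U : Filter ℕ), ∀ z ∈ α.1.down x, k n z = g z :=
      (Filter.eventually_all_finite (α.down_finite x)).2 fun z hz => hg z hz.1
    obtain ⟨n, h1, h2, h3⟩ := ((hmem x hx).and ((hg x hx).and this)).exists
    rw [← h2, (hk n).form_eq x h1, α.trunc_form h1]
    exact (α.2.free x hx).rename_congr h3
  · by_cases hc : ∀ᶠ n in (U : Filter ℕ), y ∈ k n '' (α.trunc n).1.N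
    · have : ∀ᶠ n in (U : Filter ℕ),
          ∃ x ∈ {x | x ∈ α.1.N ∧ α.1.lev x ≤ β.1.lev y}, k n x = y := by
        filter_upwards [hc] with n hn
        obtain ⟨x, hx, rfl⟩ := hn
        exact ⟨x, ⟨hx.1, (hlev n x hx).ge⟩, rfl⟩
      obtain ⟨x, hx, he⟩ := (Ultrafilter.eventually_exists_mem_iff (α.finite_lev_le _)).1 this
      obtain ⟨n, h1, h2⟩ := (he.and (hg x hx.1)).exists
      exact absurd ⟨x, hx.1, h2.symm.trans h1⟩ hn
    · have : ∀ᶠ n in (U : Filter ℕ), ∃ z ∈ {z | z ∈ α.1.N ∧ α.1.lev z ≤ β.1.lev y},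
          z ∈ (α.trunc n).1.bots ∧ β.1.lt (k n z) y := by
        filter_upwards [Ultrafilter.eventually_not.2 hc] with n hn
        obtain ⟨z, hz, hzy⟩ := (hk n).missing y hy hn
        exact ⟨z, ⟨hz.1.1, (hlev n z hz.1).symm.le.trans (β.lev_lt hzy).le⟩, hz, hzy⟩
      obtain ⟨z, hz, he⟩ := (Ultrafilter.eventually_exists_mem_iff (α.finite_lev_le _)).1 this
      obtain ⟨n, ⟨h1, h2⟩, h3, h4⟩ := (he.and ((hg z hz.1).and (hU (α.1.lev z + 1)))).exists
      refine ⟨z, ⟨hz.1, ?_⟩, by rwa [h3] at h2⟩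
      rw [← α.trunc_lab hz.1 h4]
      exact h1.2

/-- A self-embedding permutes each level and can therefore not increase labels. -/
theorem Emb.self {k : V → V} {α : LPO V L} (h : Emb k α.1 α.1) :
    Set.SurjOn k α.1.N α.1.N ∧ ∀ x ∈ α.1.N, α.1.lab (k x) ≤ α.1.lab x := by
  suffices H : ∀ x ∈ α.1.N, ∃ y ∈ α.1.N, k y = x ∧ α.1.lab (k x) ≤ α.1.lab y from
    ⟨fun x hx => let ⟨y, hy, e, _⟩ := H x hx; ⟨y, hy, e⟩, fun x hx => by
      obtain ⟨y, hy, e, hl⟩ := H x hx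
      exact hl.trans (e ▸ h.lab_le y hy)⟩
  intro x hx
  let S : Set V := {y | y ∈ α.1.N ∧ α.1.lev y = α.1.lev x}
  have hS : Set.MapsTo k S S := fun y hy => ⟨h.mapsTo hy.1, (h.lev_eq hy.1).trans hy.2⟩
  have : Finite S := α.2.finite_level _
  have hinj : Function.Injective (hS.restrict k S S) := fun y z hyz =>
    Subtype.ext (h.injOn y.2.1 z.2.1 (congrArg Subtype.val hyz))
  obtain ⟨n, hn, hp⟩ := hinj.mem_periodicPts ⟨x, hx, rfl⟩
  have hmono : ∀ (m : ℕ) (y : S), α.1.lab y ≤ α.1.lab ((hS.restrict k S S)^[m] y).1 := by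
    intro m
    induction m with
    | zero => exact fun y => le_rfl
    | succ m ih => exact fun y => (h.lab_le y y.2.1).trans (ih (hS.restrict k S S y))
  -- the predecessor of `x` in its cycle; doubling the period makes room for it
  have hper : (hS.restrict k S S)^[(n + n - 2) + 2] ⟨x, hx, rfl⟩ = ⟨x, hx, rfl⟩ := by
    rw [show n + n - 2 + 2 = n + n by omega, Function.iterate_add_apply, hp.eq, hp.eq]
  let y : S := (hS.restrict k S S)^[(n + n - 2) + 1] ⟨x, hx, rfl⟩
  rw [Function.iterate_succ_apply'] at hper
  exact ⟨y, y.2.1, congrArg Subtype.val hper,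
    hmono (n + n - 2) (hS.restrict k S S ⟨x, hx, rfl⟩)⟩

theorem iso_of_emb_of_emb {k h : V → V} {α β : LPO V L} (hk : Emb k α.1 β.1)
    (hh : Emb h β.1 α.1) : Iso α β := by
  obtain ⟨hs, hl⟩ := Emb.self (Emb.comp hk hh)
  refine iso_iff.2 ⟨k, ⟨hk.mapsTo, hk.injOn, fun y hy => ?_⟩, hk.lt_iff, fun x hx => ?_,
    hk.form_eq⟩
  · obtain ⟨x, hx, e⟩ := hs (hh.mapsTo hy)
    exact ⟨x, hx, hh.injOn (hk.mapsTo hx) hy e⟩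
  · exact le_antisymm ((hh.lab_le _ (hk.mapsTo hx)).trans (hl x hx)) (hk.lab_le x hx)

end LPO

section Pomsets

open LPO

variable {V L : Type*} [PartialOrder L] [OrderBot L]

theorem Pom.le_antisymm {A B : Pom V L} (h : A ≤ B) (h' : B ≤ A) : A = B := by
  obtain ⟨α, rfl⟩ := A.exists_eq_cls
  obtain ⟨β, rfl⟩ := B.exists_eq_cls
  obtain ⟨k, hk⟩ := cls_le_iff.1 h
  obtain ⟨g, hg⟩ := cls_le_iff.1 h'
  exact cls_eq_of_iso (iso_of_emb_of_emb hk hg)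

theorem Pom.isLUB_unique {D : Set (Pom V L)} {A B : Pom V L} (h : IsLUB D A) (h' : IsLUB D B) :
    A = B :=
  Pom.le_antisymm (h.2 h'.1) (h'.2 h.1)

/-- The isomorphism class of a finite `α`, as a finite pomset. -/
def fcls (α : LPO V L) (h : α.1.N.Finite) : FinPom V L := ⟨cls α, fun _ => finite_of_mem_cls h⟩

/-- A pomset is determined from below by the finite pomsets under it. -/
theorem Pom.le_of_forall_fin {A B : Pom V L} (h : ∀ F : FinPom V L, F.1 ≤ A → F.1 ≤ B) :
    A ≤ B := by
  obtain ⟨α, rfl⟩ := A.exists_eq_cls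
  obtain ⟨β, rfl⟩ := B.exists_eq_cls
  refine cls_le_iff.2 (exists_emb_of_trunc fun n => cls_le_iff.1 ?_)
  exact h (fcls (α.trunc n) (α.trunc_finite n)) (cls_le_of_le (α.trunc_le n))

theorem FinPom.exists_le_le {A : Pom V L} {F G : FinPom V L} (hF : F.1 ≤ A) (hG : G.1 ≤ A) :
    ∃ H : FinPom V L, H.1 ≤ A ∧ F ≤ H ∧ G ≤ H := by
  obtain ⟨α, hα⟩ := A.exists_mem
  obtain ⟨φ, hφ, hφα⟩ := hF α hα
  obtain ⟨γ, hγ, hγα⟩ := hG α hα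
  obtain ⟨n, hn⟩ := exists_le_trunc hφα (F.2 φ hφ)
  obtain ⟨m, hm⟩ := exists_le_trunc hγα (G.2 γ hγ)
  refine ⟨fcls (α.trunc (max n m)) (α.trunc_finite _), ?_, ?_, ?_⟩
  · rw [eq_cls_of_mem hα]
    exact cls_le_of_le (α.trunc_le _)
  · change F.1 ≤ cls _
    rw [eq_cls_of_mem hφ]
    exact cls_le_of_le (hn _ (le_max_left _ _))
  · change G.1 ≤ cls _
    rw [eq_cls_of_mem hγ]
    exact cls_le_of_le (hm _ (le_max_right _ _))

end Pomsets

/-! ### Suprema of directed sets -/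

section Settled

open PreLPO LPO

theorem wellFoundedGT_of_directed {L : Type*} [PartialOrder L]
    (hdcpo : ∀ D : Set L, D.Nonempty → DirectedOn (· ≤ ·) D → ∃ l, IsLUB D l)
    (hfp : ∀ l : L, (Set.Iio l).Finite) : WellFoundedGT L := by
  refine wellFoundedGT_iff_monotone_chain_condition.2 fun a => ?_
  obtain ⟨l, hl⟩ := hdcpo (Set.range a) (Set.range_nonempty a)
    (directedOn_range.2 a.monotone.directed_le)
  have hfin : (Set.range a).Finite := by
    refine ((hfp l).insert l).subset fun x hx => ?_
    exact (hl.1 hx).eq_or_lt.imp id id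
  obtain ⟨_, ⟨n, rfl⟩, hmax⟩ := hfin.exists_maximal (Set.range_nonempty a)
  exact ⟨n, fun m hm => le_antisymm (a.monotone hm) (hmax ⟨m, rfl⟩ (a.monotone hm))⟩

/-- Increasing labels makes their multiset smaller, for the order dual to that of `L`. -/
theorem isDershowitzMannaLT_map {V L : Type*} [PartialOrder L] (S : Finset V) {f g : V → L}
    (h : ∀ x ∈ S, f x ≤ g x) {a : V} (ha : a ∈ S) (hne : f a ≠ g a) :
    Multiset.IsDershowitzMannaLT (S.val.map fun x => OrderDual.toDual (g x))
      (S.val.map fun x => OrderDual.toDual (f x)) := by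
  classical
  refine ⟨(S.val.filter fun x => f x = g x).map fun x => OrderDual.toDual (f x),
    (S.val.filter fun x => ¬ f x = g x).map fun x => OrderDual.toDual (g x),
    (S.val.filter fun x => ¬ f x = g x).map fun x => OrderDual.toDual (f x), ?_, ?_, ?_, ?_⟩
  · intro h0
    have : a ∈ S.val.filter fun x => ¬ f x = g x := Multiset.mem_filter.2 ⟨ha, hne⟩
    rw [Multiset.empty_eq_zero, Multiset.map_eq_zero] at h0
    rw [h0] at this
    exact Multiset.notMem_zero a this
  · conv_lhs => rw [← Multiset.filter_add_not (fun x => f x = g x) S.val, Multiset.map_add]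
    congr 1
    refine Multiset.map_congr rfl fun x hx => ?_
    rw [(Multiset.mem_filter.1 hx).2]
  · conv_lhs => rw [← Multiset.filter_add_not (fun x => f x = g x) S.val, Multiset.map_add]
  · intro y hy
    obtain ⟨x, hx, rfl⟩ := Multiset.mem_map.1 hy
    refine ⟨_, Multiset.mem_map_of_mem _ hx, OrderDual.toDual_lt_toDual.2 ?_⟩
    have := Multiset.mem_filter.1 hx
    exact lt_of_le_of_ne (h x this.1) this.2

variable {V L : Type*} [PartialOrder L] [OrderBot L]

/-- The nodes of `α` below level `n`, and their labels, do not change any more when the class of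
`α` grows within `D`. -/
def Settled (D : Set (Pom V L)) (n : ℕ) (α : LPO V L) : Prop :=
  cls α ∈ D ∧ ∀ (β : LPO V L) (k : V → V), cls β ∈ D → Emb k α.1 β.1 →
    ∀ y ∈ β.1.N, β.1.lev y < n → ∃ x ∈ α.1.N, k x = y ∧ β.1.lab y = α.1.lab x

theorem Settled.of_iso {D : Set (Pom V L)} {n : ℕ} {α β : LPO V L} (h : Settled D n α)
    (hi : Iso α β) : Settled D n β := by
  obtain ⟨g, hg⟩ := iso_iff.1 hi
  refine ⟨cls_eq_of_iso hi ▸ h.1, fun γ k hγ hk y hy hn => ?_⟩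
  obtain ⟨x, hx, e, hl⟩ := h.2 γ (k ∘ g) hγ (Emb.comp hg.emb hk) y hy hn
  exact ⟨g x, hg.bijOn.mapsTo hx, e, hl.trans (hg.lab_eq x hx).symm⟩

/-- One more level can be settled. If the levels below `n` are settled then so are the nodes of
level `n`, since a new one would lie above a bottom node that has changed its label. The multiset
of their labels cannot grow for ever, because its Dershowitz–Manna order is well-founded. -/
theorem Settled.exists_succ [WellFoundedGT L] {D : Set (Pom V L)} {n : ℕ} {α : LPO V L}
    (h : Settled D n α) : ∃ (β : LPO V L) (k : V → V), Emb k α.1 β.1 ∧ Settled D (n + 1) β := by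
  classical
  let S : LPO V L → Finset V := fun β => (β.finite_lev_lt (n + 1)).toFinset
  have hS : ∀ {β : LPO V L} {x : V}, x ∈ S β ↔ x ∈ β.1.N ∧ β.1.lev x < n + 1 := fun {β x} =>
    Set.Finite.mem_toFinset _
  let μ : LPO V L → Multiset Lᵒᵈ := fun β => (S β).val.map fun x => OrderDual.toDual (β.1.lab x)
  obtain ⟨β, ⟨hβD, g, hg⟩, hmin⟩ := (InvImage.wf μ
    (Multiset.wellFounded_isDershowitzMannaLT (α := Lᵒᵈ))).has_min
    {β | cls β ∈ D ∧ ∃ k, Emb k α.1 β.1} ⟨α, h.1, id, (Le.refl α).emb⟩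
  refine ⟨β, g, hg, hβD, fun γ k hγ hk => ?_⟩
  have hgk := Emb.comp hg hk
  have hsurj : ∀ y ∈ γ.1.N, γ.1.lev y < n + 1 → ∃ x ∈ β.1.N, k x = y := by
    intro y hy hn
    by_contra hc
    obtain ⟨z, hz, hzy⟩ := hk.missing y hy fun ⟨x, hx, e⟩ => hc ⟨x, hx, e⟩
    have hlev : γ.1.lev (k z) < n := by
      have := γ.lev_lt hzy
      omega
    obtain ⟨x, hx, e, hl⟩ := h.2 γ _ hγ hgk _ (hk.mapsTo hz.1) hlev
    have e' : g x = z := hk.injOn (hg.mapsTo hx) hz.1 e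
    refine γ.not_lt_of_bot ⟨hk.mapsTo hz.1, ?_⟩ hzy
    rw [hl]
    exact le_bot_iff.1 ((hg.lab_le x hx).trans (by rw [e', hz.2]))
  have hSγ : S γ = (S β).image k := by
    ext y
    rw [Finset.mem_image, hS]
    constructor
    · rintro ⟨hy, hn⟩
      obtain ⟨x, hx, rfl⟩ := hsurj y hy hn
      exact ⟨x, hS.2 ⟨hx, by rwa [hk.lev_eq hx] at hn⟩, rfl⟩
    · rintro ⟨x, hx, rfl⟩
      have := hS.1 hx
      exact ⟨hk.mapsTo this.1, by rw [hk.lev_eq this.1]; exact this.2⟩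
  intro y hy hn
  obtain ⟨x, hx, rfl⟩ := hsurj y hy hn
  refine ⟨x, hx, rfl, ?_⟩
  by_contra hne
  refine hmin γ ⟨hγ, _, hgk⟩ ?_
  have hinj : Set.InjOn k (S β) := hk.injOn.mono fun x hx => (hS.1 hx).1
  have hμ : μ γ = (S β).val.map fun x => OrderDual.toDual (γ.1.lab (k x)) := by
    change (S γ).val.map _ = _
    rw [hSγ, Finset.image_val_of_injOn hinj, Multiset.map_map]
    rfl
  rw [InvImage, hμ]
  exact isDershowitzMannaLT_map (S β) (fun x hx => hk.lab_le x (hS.1 hx).1)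
    (hS.2 ⟨hx, by rwa [hk.lev_eq hx] at hn⟩) (Ne.symm hne)

/-- An extension of `α` has a representative that literally extends `α`, provided that there is
room for its additional nodes. -/
theorem exists_iso_le {α β : LPO V L} {k : V → V} (hk : Emb k α.1 β.1) {e : ℕ → V}
    (he : Function.Injective e) (hd : ∀ i, e i ∉ α.1.N) :
    ∃ β', Iso β β' ∧ Le α β' ∧ β'.1.N ⊆ α.1.N ∪ Set.range e := by
  classical
  obtain ⟨r, hr, -⟩ := α.exists_root_le
  have : Nonempty V := ⟨r⟩
  obtain ⟨c, hc⟩ := Set.countable_iff_exists_injOn.1 β.2.countable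
  let g : V → V := fun y => if y ∈ k '' α.1.N then Function.invFunOn k α.1.N y else e (c y)
  have hg1 : ∀ x ∈ α.1.N, g (k x) = x := fun x hx =>
    (if_pos ⟨x, hx, rfl⟩).trans (hk.injOn.leftInvOn_invFunOn hx)
  have hg2 : ∀ y, y ∉ k '' α.1.N → g y = e (c y) := fun y hy => if_neg hy
  have hinj : Set.InjOn g β.1.N := by
    intro y hy z hz hyz
    by_cases h1 : y ∈ k '' α.1.N <;> by_cases h2 : z ∈ k '' α.1.N
    · obtain ⟨a, ha, rfl⟩ := h1
      obtain ⟨b, hb, rfl⟩ := h2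
      rw [hg1 a ha, hg1 b hb] at hyz
      rw [hyz]
    · obtain ⟨a, ha, rfl⟩ := h1
      rw [hg1 a ha, hg2 z h2] at hyz
      exact absurd (hyz ▸ ha) (hd _)
    · obtain ⟨b, hb, rfl⟩ := h2
      rw [hg1 b hb, hg2 y h1] at hyz
      exact absurd (hyz ▸ hb) (hd _)
    · rw [hg2 y h1, hg2 z h2] at hyz
      exact hc hy hz (he hyz)
  refine ⟨β.map g hinj, iso_iff.2 ⟨g, β.isoBy_map hinj⟩,
    Emb.le (Emb.comp hk (β.isoBy_map hinj).emb) hg1, ?_⟩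
  rintro _ ⟨y, hy, rfl⟩
  by_cases h1 : y ∈ k '' α.1.N
  · obtain ⟨a, ha, rfl⟩ := h1
    rw [hg1 a ha]
    exact Or.inl ha
  · exact Or.inr ⟨_, (hg2 y h1).symm⟩

theorem le_of_le_succ {α : ℕ → LPO V L} (hle : ∀ n, Le (α n) (α (n + 1))) {m n : ℕ}
    (hmn : m ≤ n) : Le (α m) (α n) := by
  induction n, hmn using Nat.le_induction with
  | base => exact Le.refl _
  | succ n _ ih => exact ih.trans (hle n)

/-- A chain whose low levels become constant has a union. -/
theorem exists_union {α : ℕ → LPO V L} (hle : ∀ n, Le (α n) (α (n + 1)))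
    (hset : ∀ m n, m ≤ n → ∀ x ∈ (α n).1.N, (α n).1.lev x < m →
      x ∈ (α m).1.N ∧ (α n).1.lab x = (α m).1.lab x) :
    ∃ γ : LPO V L, (∀ n, Le (α n) γ) ∧ ∀ n, ∀ x ∈ γ.1.N, γ.1.lev x < n →
      x ∈ (α n).1.N ∧ γ.1.lab x = (α n).1.lab x := by
  have hmono : ∀ {m n}, m ≤ n → Le (α m) (α n) := fun hmn => le_of_le_succ hle hmn
  have hlab : ∀ x, ∃ l, ∀ᶠ n in Filter.atTop, (α n).1.lab x = l := by
    intro x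
    by_cases hx : ∃ m, x ∈ (α m).1.N
    · obtain ⟨m, hm⟩ := hx
      refine ⟨_, Filter.eventually_atTop.2
        ⟨max m ((α m).1.lev x + 1), fun n hn => (hset _ n hn x ?_ ?_).2⟩⟩
      · exact (hmono ((le_max_left _ _).trans hn)).subset hm
      · rw [(hmono ((le_max_left _ _).trans hn)).lev_eq hm]
        exact Nat.lt_of_lt_of_le (Nat.lt_succ_self _) (le_max_right _ _)
    · exact ⟨⊥, Filter.Eventually.of_forall fun n => (α n).2.lab_out x fun h => hx ⟨n, h⟩⟩
  have hform : ∀ x, ∃ ψ, ∀ᶠ n in Filter.atTop, (α n).1.form x = ψ := by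
    intro x
    by_cases hx : ∃ m, x ∈ (α m).1.N
    · obtain ⟨m, hm⟩ := hx
      exact ⟨_, Filter.eventually_atTop.2 ⟨m, fun n hn => ((hmono hn).form_eq x hm).symm⟩⟩
    · exact ⟨Form.tru, Filter.Eventually.of_forall fun n =>
        (α n).2.form_out x fun h => hx ⟨n, h⟩⟩
  choose lab hlab using hlab
  choose form hform using hform
  let γ : PreLPO V L :=
    { N := {x | ∃ n, x ∈ (α n).1.N}
      lt := fun x y => ∃ n, (α n).1.lt x y
      lab := lab
      form := form }
  have hN : ∀ {x : V}, x ∈ γ.N → ∀ᶠ n in Filter.atTop, x ∈ (α n).1.N := fun ⟨m, hm⟩ =>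
    Filter.eventually_atTop.2 ⟨m, fun n hn => (hmono hn).subset hm⟩
  have hlt : ∀ {x y : V}, γ.lt x y → ∀ᶠ n in Filter.atTop, (α n).1.lt x y := fun ⟨m, hm⟩ =>
    Filter.eventually_atTop.2 ⟨m, fun _ hn => (((hmono hn).lt_iff _ _).1 hm).1⟩
  have hge : ∀ m : ℕ, ∀ᶠ n in Filter.atTop, m ≤ n := fun m => Filter.eventually_ge_atTop m
  have hback : ∀ {m x y}, γ.lt x y → y ∈ (α m).1.N → (α m).1.lt x y := by
    intro m x y h hy
    obtain ⟨n, h1, h2⟩ := ((hlt h).and (hge m)).exists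
    have hx := (hmono h2).down_closed y hy ⟨((α n).2.lt_mem _ _ h1).1, h1⟩
    exact ((hmono h2).lt_iff _ _).2 ⟨h1, hx, hy⟩
  have hemb : ∀ n, OrderEmb id (α n).1 γ := fun n =>
    { mapsTo := fun x hx => ⟨n, hx⟩
      injOn := Set.injOn_id _
      lt_iff := fun x _ y hy => ⟨fun h => hback h hy, fun h => ⟨n, h⟩⟩
      down := fun x hx y _ h => ⟨y, ((α n).2.lt_mem _ _ (hback h hx)).1, rfl⟩ }
  have hlev : ∀ {n x}, x ∈ (α n).1.N → γ.lev x = (α n).1.lev x := fun {n x} hx =>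
    (hemb n).lev_eq hx
  have hdown : ∀ {n x}, x ∈ (α n).1.N → γ.down x = (α n).1.down x := by
    intro n x hx
    ext y
    exact ⟨fun h => ⟨((α n).2.lt_mem _ _ (hback h.2 hx)).1, hback h.2 hx⟩,
      fun h => ⟨⟨n, h.1⟩, ⟨n, h.2⟩⟩⟩
  have hsettle : ∀ n, ∀ x ∈ γ.N, γ.lev x < n → x ∈ (α n).1.N ∧ γ.lab x = (α n).1.lab x := by
    intro n x hx hn
    obtain ⟨m, h1, h2, h3⟩ := ((hN hx).and ((hge n).and (hlab x))).exists
    have := hset n m h2 x h1 (by rwa [hlev h1] at hn)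
    exact ⟨this.1, h3.symm.trans this.2⟩
  have hγ : γ.IsLPO := by
    refine isLPO_of_root ?_ ?_ ?_ ?_ ?_ ?_ ?_ ?_ ?_ ?_ ?_ ?_ ?_
    · rintro x y ⟨n, h⟩
      exact ⟨⟨n, ((α n).2.lt_mem _ _ h).1⟩, ⟨n, ((α n).2.lt_mem _ _ h).2⟩⟩
    · intro x hx
      obtain ⟨n, hn⟩ := (hlab x).exists
      exact hn.symm.trans ((α n).2.lab_out x fun h => hx ⟨n, h⟩)
    · intro x hx
      obtain ⟨n, hn⟩ := (hform x).exists
      exact hn.symm.trans ((α n).2.form_out x fun h => hx ⟨n, h⟩)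
    · have : γ.N = ⋃ n, (α n).1.N := by
        ext x
        exact Set.mem_iUnion.symm
      rw [this]
      exact Set.countable_iUnion fun n => (α n).2.countable
    · rintro x ⟨n, h⟩
      exact (α n).2.irrefl x h
    · intro x y z h h'
      obtain ⟨n, h1, h2⟩ := ((hlt h).and (hlt h')).exists
      exact ⟨n, (α n).2.trans _ _ _ h1 h2⟩
    · rintro x ⟨n, hx⟩
      rw [hdown hx]
      exact (α n).2.finitely_preceded x hx
    · intro n
      refine ((α (n + 1)).finite_lev_le n).subset ?_
      rintro x ⟨hx, hn⟩
      have := (hsettle (n + 1) x hx (by omega)).1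
      exact ⟨this, by rw [← hlev this, hn]⟩
    · obtain ⟨r, hr, hrle⟩ := (α 0).exists_root_le
      have hr0 := (α 0).lev_root hr hrle
      refine ⟨r, ⟨0, hr⟩, fun x hx => ?_⟩
      obtain ⟨n, hn, -⟩ := ((hN hx).and (hge 0)).exists
      obtain ⟨s, hs, hsle⟩ := (α n).exists_root_le
      rcases hsle r ((hmono n.zero_le).subset hr) with rfl | h
      · exact (hsle x hn).imp id fun h => ⟨n, h⟩
      · have := (α n).lev_lt h
        rw [(hmono n.zero_le).lev_eq hr, hr0] at this
        omega
    · intro x hx hb y hxy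
      obtain ⟨n, h1, h2, h3⟩ := ((hlt hxy).and ((hN hx).and (hlab x))).exists
      exact (α n).not_lt_of_bot ⟨h2, h3.trans hb⟩ h1
    · intro x hx
      obtain ⟨n, h1, h2⟩ := ((hN hx).and (hform x)).exists
      exact (congrArg Form.Sat h2).mp ((α n).2.sat x h1)
    · intro x hx
      obtain ⟨n, h1, h2⟩ := ((hN hx).and (hform x)).exists
      rw [hdown h1]
      exact (congrArg (Form.FreeIn · _) h2).mp ((α n).2.free x h1)
    · intro x y hxy
      obtain ⟨n, h1, h2, h3⟩ := ((hlt hxy).and ((hform x).and (hform y))).exists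
      have := (α n).2.form_mono _ _ h1
      rwa [h2, h3] at this
  refine ⟨⟨γ, hγ⟩, fun m => ?_, hsettle⟩
  refine le_of_missing (fun x hx => ⟨m, hx⟩) (fun x hx y h => ((α m).2.lt_mem _ _ (hback h hx)).1)
    (hemb m).lt_iff (fun x hx => ?_) (fun x hx => ?_) fun y hy hn => ?_
  · obtain ⟨n, h1, h2⟩ := ((hlab x).and (hge m)).exists
    exact ((hmono h2).lab_le x hx).trans h1.le
  · obtain ⟨n, h1, h2⟩ := ((hform x).and (hge m)).exists
    exact ((hmono h2).form_eq x hx).trans h1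
  · obtain ⟨n, h1, h2⟩ := ((hN hy).and (hge m)).exists
    obtain ⟨z, hz, -, hzy⟩ := (hmono h2).missing h1 hn
    exact ⟨z, hz, n, hzy⟩

theorem exists_settled_chain [Infinite V] [WellFoundedGT L] {D : Set (Pom V L)}
    (hD : D.Nonempty) :
    ∃ α : ℕ → LPO V L, (∀ n, Settled D n (α n)) ∧ ∀ n, Le (α n) (α (n + 1)) := by
  let e : ℕ × ℕ → V := Infinite.natEmbedding V ∘ Nat.pairEquiv
  have he : Function.Injective e := (Infinite.natEmbedding V).injective.comp Nat.pairEquiv.injective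
  -- the nodes of the `n`-th member are taken from the first `n + 1` rows of `e`
  let Q : ℕ → LPO V L → Prop := fun n α => Settled D n α ∧ α.1.N ⊆ e '' {p | p.1 ≤ n}
  have hbase : ∃ α, Q 0 α := by
    obtain ⟨A, hA⟩ := hD
    obtain ⟨α, rfl⟩ := A.exists_eq_cls
    obtain ⟨c, hc⟩ := Set.countable_iff_exists_injOn.1 α.2.countable
    have hinj : Set.InjOn (fun x => e (0, c x)) α.1.N := fun x hx y hy h =>
      hc hx hy (congrArg Prod.snd (he h))
    refine ⟨α.map _ hinj, Settled.of_iso ⟨hA, ?_⟩ (iso_iff.2 ⟨_, α.isoBy_map hinj⟩), ?_⟩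
    · exact fun _ _ _ _ _ _ h => absurd h (Nat.not_lt_zero _)
    · rintro _ ⟨x, -, rfl⟩
      exact ⟨(0, c x), le_refl 0, rfl⟩
  have hstep : ∀ n α, Q n α → ∃ β, Q (n + 1) β ∧ Le α β := by
    rintro n α ⟨hs, hN⟩
    obtain ⟨β, k, hk, hβ⟩ := hs.exists_succ
    obtain ⟨β', hi, hle, hN'⟩ := exists_iso_le hk (e := fun i => e (n + 1, i))
      (fun i j h => congrArg Prod.snd (he h)) fun i hi => by
        obtain ⟨p, hp, h⟩ := hN hi
        rw [he h] at hp
        exact absurd hp (Nat.not_succ_le_self n)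
    refine ⟨β', ⟨hβ.of_iso hi, fun x hx => ?_⟩, hle⟩
    rcases hN' hx with h | ⟨i, rfl⟩
    · obtain ⟨p, hp, rfl⟩ := hN h
      exact ⟨p, Nat.le_succ_of_le hp, rfl⟩
    · exact ⟨(n + 1, i), le_refl (n + 1), rfl⟩
  obtain ⟨α0, h0⟩ := hbase
  choose next hnext hle using hstep
  let a : ∀ n, {α // Q n α} := fun n =>
    Nat.rec ⟨α0, h0⟩ (fun n p => ⟨next n p.1 p.2, hnext n p.1 p.2⟩) n
  exact ⟨fun n => (a n).1, fun n => (a n).2.1, fun n => hle n (a n).1 (a n).2⟩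

/-- Non-empty directed sets have suprema, and finite pomsets are compact. The supremum is the
union of a chain of representatives in which level after level is settled. -/
theorem Pom.exists_isLUB_of_nonempty [Infinite V] [WellFoundedGT L] {D : Set (Pom V L)}
    (hne : D.Nonempty) (hD : DirectedOn (· ≤ ·) D) :
    ∃ S, IsLUB D S ∧ ∀ F : FinPom V L, F.1 ≤ S → ∃ A ∈ D, F.1 ≤ A := by
  obtain ⟨α, hα, hle⟩ := exists_settled_chain hne
  have hmono : ∀ {m n}, m ≤ n → Le (α m) (α n) := fun hmn => le_of_le_succ hle hmn
  obtain ⟨γ, hγ, hset⟩ := exists_union hle fun m n hmn x hx hlev => by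
    obtain ⟨y, hy, e, hl⟩ := (hα m).2 (α n) id (hα n).1 (hmono hmn).emb x hx hlev
    obtain rfl : y = x := e
    exact ⟨hy, hl⟩
  have hcompact : ∀ F : FinPom V L, F.1 ≤ cls γ → ∃ n, F.1 ≤ cls (α n) := by
    intro F hF
    obtain ⟨φ, hφ, hφγ⟩ := hF γ (Iso.refl γ)
    obtain ⟨n, hn⟩ := exists_lev_lt_of_finite (F.2 φ hφ)
    have hs : ∀ x ∈ φ.1.N, x ∈ (α n).1.N ∧ γ.1.lab x = (α n).1.lab x := fun x hx =>
      hset n x (hφγ.subset hx) (by rw [hφγ.lev_eq hx]; exact hn x hx)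
    refine ⟨n, ?_⟩
    rw [eq_cls_of_mem hφ]
    exact cls_le_of_le (hφγ.of_le (hγ n) (fun x hx => (hs x hx).1) fun x hx =>
      (hφγ.lab_le x hx).trans (hs x hx).2.le)
  refine ⟨cls γ, ⟨fun A hA => Pom.le_of_forall_fin fun F hF => ?_,
    fun B hB => Pom.le_of_forall_fin fun F hF => ?_⟩, fun F hF => ?_⟩
  · obtain ⟨φ, hφF⟩ := F.1.exists_mem
    obtain ⟨n, hn⟩ := exists_lev_lt_of_finite (F.2 φ hφF)
    obtain ⟨B, hB, hAB, hnB⟩ := hD A hA _ (hα n).1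
    obtain ⟨β, rfl⟩ := B.exists_eq_cls
    have hφβ := hF.trans hAB
    rw [eq_cls_of_mem hφF] at hφβ ⊢
    refine le_trans ?_ (cls_le_of_le (hγ n))
    obtain ⟨φ', hφ', hle'⟩ := hφβ β (Iso.refl β)
    obtain ⟨α', hα', hαle⟩ := hnB β (Iso.refl β)
    rw [cls_eq_of_iso hφ', cls_eq_of_iso hα']
    -- all that `F` can see of `β` lies in the settled part of `α n`
    have hs : ∀ x ∈ φ'.1.N, x ∈ α'.1.N ∧ β.1.lab x = α'.1.lab x := by
      intro x hx
      obtain ⟨i, hi⟩ := iso_iff.1 hα'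
      obtain ⟨j, hj⟩ := iso_iff.1 hφ'
      obtain ⟨w, hw, rfl⟩ := hj.bijOn.surjOn hx
      obtain ⟨y, hy, e, hl⟩ := (hα n).2 β _ hB (Emb.comp hi.emb hαle.emb) _ (hle'.subset hx)
        (by rw [hle'.lev_eq hx, hj.orderEmb.lev_eq hw]; exact hn w hw)
      rw [← e]
      rw [← e] at hl
      exact ⟨hi.bijOn.mapsTo hy, hl.trans (hi.lab_eq y hy).symm⟩
    exact cls_le_of_le (hle'.of_le hαle (fun x hx => (hs x hx).1) fun x hx =>
      (hle'.lab_le x hx).trans (hs x hx).2.le)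
  · obtain ⟨n, hn⟩ := hcompact F hF
    exact hn.trans (hB (hα n).1)
  · obtain ⟨n, hn⟩ := hcompact F hF
    exact ⟨_, (hα n).1, hn⟩

/-- A pomset all of whose nodes are bottom nodes is least. Such a pomset has one node. -/
theorem isBot_cls_of_lab_eq_bot {α : LPO V L} (h : ∀ x ∈ α.1.N, α.1.lab x = ⊥) :
    IsBot (cls α) := by
  intro B
  obtain ⟨β, rfl⟩ := B.exists_eq_cls
  obtain ⟨r, hr, -⟩ := α.exists_root_le
  obtain ⟨s, hs, hsle⟩ := β.exists_root_le
  have hlt : ∀ x ∈ α.1.N, ∀ y, ¬ α.1.lt x y := fun x hx y => α.not_lt_of_bot ⟨hx, h x hx⟩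
  have hone : ∀ x ∈ α.1.N, x = r := by
    obtain ⟨t, ht, htle⟩ := α.exists_root_le
    have hall : ∀ x ∈ α.1.N, t = x := fun x hx => (htle x hx).resolve_right (hlt t ht x)
    exact fun x hx => (hall x hx).symm.trans (hall r hr)
  have hmin : ∀ y, ¬ β.1.lt y s := fun y hy => by
    have := β.lev_lt hy
    rw [β.lev_root hs hsle] at this
    omega
  have htru : ∀ (δ : LPO V L), ∀ x ∈ δ.1.N, (∀ y, ¬ δ.1.lt y x) → δ.1.form x = Form.tru :=
    fun δ x hx hm => ((δ.2.free x hx).mono fun y hy => (hm y hy.2).elim).eq_tru (δ.2.sat x hx)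
  refine cls_le_iff.2 ⟨fun _ => s, ⟨⟨fun _ _ => hs, fun x hx y hy _ => ?_, fun x hx y hy => ?_,
    fun x hx y _ hys => (hmin y hys).elim⟩, fun x hx => ?_, fun x hx => ?_, fun y hy hn => ?_⟩⟩
  · rw [hone x hx, hone y hy]
  · exact iff_of_false (hmin s) (hlt x hx y)
  · rw [h x hx]
    exact bot_le
  · have hm : ∀ y, ¬ α.1.lt y x := fun y hy => hlt y (α.2.lt_mem _ _ hy).1 x hy
    rw [htru β s hs hmin, htru α x hx hm]
    exact Form.ext_holds fun v => by simp
  · refine ⟨r, ⟨hr, h r hr⟩, (hsle y hy).resolve_left fun e => hn ⟨r, hr, e⟩⟩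

/-- The pomset with a single bottom node. -/
theorem LPO.exists_lab_eq_bot [Infinite V] :
    ∃ α : LPO V L, α.1.N.Finite ∧ ∀ x ∈ α.1.N, α.1.lab x = ⊥ := by
  obtain ⟨v⟩ : Nonempty V := inferInstance
  let α : PreLPO V L := ⟨{v}, fun _ _ => False, fun _ => ⊥, fun _ => Form.tru⟩
  have hfin : α.N.Finite := Set.finite_singleton v
  refine ⟨⟨α, isLPO_of_root (fun _ _ h => h.elim) (fun _ _ => rfl) (fun _ _ => rfl)
    hfin.countable (fun _ h => h) (fun _ _ _ h => h.elim) (fun _ _ => hfin.subset fun _ h => h.1)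
    (fun _ => hfin.subset fun _ h => h.1) ⟨v, rfl, fun x hx => Or.inl hx.symm⟩
    (fun _ _ _ _ h => h) (fun _ _ => ⟨fun _ => true, trivial⟩) (fun _ _ => Form.FreeIn.tru _)
    (fun _ _ h => h.elim)⟩, hfin, fun _ _ => rfl⟩

theorem Pom.exists_isLUB [Infinite V] [WellFoundedGT L] {D : Set (Pom V L)}
    (hD : DirectedOn (· ≤ ·) D) : ∃ S, IsLUB D S := by
  rcases D.eq_empty_or_nonempty with rfl | hne
  · obtain ⟨α, -, hα⟩ := LPO.exists_lab_eq_bot (V := V) (L := L)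
    exact ⟨cls α, isLUB_empty_iff.2 (isBot_cls_of_lab_eq_bot hα)⟩
  · obtain ⟨S, hS, -⟩ := Pom.exists_isLUB_of_nonempty hne hD
    exact ⟨S, hS⟩

theorem FinPom.exists_le_of_isLUB [Infinite V] [WellFoundedGT L] {D : Set (Pom V L)}
    (hne : D.Nonempty) (hD : DirectedOn (· ≤ ·) D) {S : Pom V L} (hS : IsLUB D S)
    {F : FinPom V L} (hF : F.1 ≤ S) : ∃ A ∈ D, F.1 ≤ A := by
  obtain ⟨S', hS', hc⟩ := Pom.exists_isLUB_of_nonempty hne hD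
  exact hc F (Pom.isLUB_unique hS hS' ▸ hF)

end Settled

/-! ### Branches -/

namespace LPO

open PreLPO

variable {V L : Type*}

section Branches

variable [LE L] [OrderBot L] {α : LPO V L}

theorem holds_stuck (hα : α.1.N.Finite) (v : V → Bool) :
    α.stuck.Holds v ↔ ∃ x ∈ α.1.bots, (α.1.form x).Holds v :=
  Form.holds_bigOr (hα.subset fun _ h => h.1) v

theorem holds_bigAnd_form (hα : α.1.N.Finite) {S : Set V} (hS : S ⊆ α.extens) (v : V → Bool) :
    (Form.bigAnd α.1.form S).Holds v ↔ ∀ x ∈ S, (α.1.form x).Holds v :=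
  Form.holds_bigAnd (hα.subset fun _ h => (hS h).1) v

theorem free_stuck (hα : α.1.N.Finite) : α.stuck.FreeIn α.1.N :=
  Form.FreeIn.bigOr (hα.subset fun _ h => h.1) fun _ hx => α.free_nodes hx.1

theorem sat_of_mem_br {ψ : Form V} (h : ψ ∈ α.br) : ψ.Sat :=
  let ⟨_, _, _, _, h, _⟩ := h
  h

theorem not_implies_bot (hα : α.1.N.Finite) {ψ : Form V} (h : ψ ∈ α.br) {z : V}
    (hz : z ∈ α.1.bots) : ¬ ψ.Implies (α.1.form z) := by
  obtain ⟨S, -, -, -, ⟨v, hv⟩, hst, -⟩ := h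
  intro hi
  exact (Form.holds_not _ _).1 (hst v hv) ((holds_stuck hα v).2 ⟨z, hz, hi v hv⟩)

theorem exists_implies_of_mem_br (hα : α.1.N.Finite) {ψ : Form V} (h : ψ ∈ α.br) :
    ∃ x ∈ α.1.N, ψ.Implies (α.1.form x) := by
  obtain ⟨S, ⟨x, hx⟩, hS, rfl, -⟩ := h
  exact ⟨x, (hS hx).1, fun v hv => (holds_bigAnd_form hα hS v).1 hv x hx⟩

/-- The variables of a branch are nodes on that branch. -/
theorem free_br (hα : α.1.N.Finite) {ψ : Form V} (h : ψ ∈ α.br) :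
    ψ.FreeIn {x | x ∈ α.1.N ∧ ψ.Implies (α.1.form x)} := by
  obtain ⟨S, -, hS, rfl, -⟩ := h
  refine Form.FreeIn.bigAnd (hα.subset fun _ h => (hS h).1) fun x hx => ?_
  refine (α.2.free x (hS hx).1).mono fun y hy => ⟨hy.1, fun v hv => ?_⟩
  exact α.2.form_mono _ _ hy.2 v ((holds_bigAnd_form hα hS v).1 hv x hx)

theorem free_br_nodes (hα : α.1.N.Finite) {ψ : Form V} (h : ψ ∈ α.br) : ψ.FreeIn α.1.N :=
  (free_br hα h).mono fun _ hx => hx.1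

theorem br_finite (hα : α.1.N.Finite) : α.br.Finite := by
  refine (hα.finite_subsets.image (Form.bigAnd α.1.form)).subset ?_
  rintro ψ ⟨S, -, hS, rfl, -⟩
  exact ⟨S, fun x hx => (hS hx).1, rfl⟩

theorem rename_mem_br {α' : LPO V L} {k : V → V} (h : IsoBy k α.1 α'.1) (hα : α.1.N.Finite)
    {ψ : Form V} (hψ : ψ ∈ α.br) : ψ.rename k ∈ α'.br := by
  have hα' : α'.1.N.Finite := by
    rw [← h.bijOn.image_eq]
    exact hα.image k
  obtain ⟨r, hr, -⟩ := α.exists_root_le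
  have : Nonempty V := ⟨r⟩
  have hst : α'.stuck = α.stuck.rename k := Form.ext_holds fun v => by
    rw [holds_stuck hα', Form.holds_rename, holds_stuck hα]
    constructor
    · rintro ⟨y, ⟨hy, hb⟩, hv⟩
      obtain ⟨x, hx, rfl⟩ := h.bijOn.surjOn hy
      rw [h.lab_eq x hx] at hb
      rw [h.form_eq x hx, Form.holds_rename] at hv
      exact ⟨x, ⟨hx, hb⟩, hv⟩
    · rintro ⟨x, ⟨hx, hb⟩, hv⟩
      refine ⟨k x, ⟨h.bijOn.mapsTo hx, (h.lab_eq x hx).trans hb⟩, ?_⟩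
      rwa [h.form_eq x hx, Form.holds_rename]
  have hext : ∀ x ∈ α.1.N, k x ∈ α'.extens ↔ x ∈ α.extens := fun x hx => by
    change (_ ∧ _) ↔ (_ ∧ _)
    rw [h.form_eq x hx, hst, (α.free_nodes hx).implies_rename (free_stuck hα) h.bijOn.injOn]
    simp [h.bijOn.mapsTo hx, hx]
  have himg : ∀ S ⊆ α.extens, k '' S ⊆ α'.extens := by
    rintro S hS _ ⟨x, hx, rfl⟩
    exact (hext x (hS hx).1).2 (hS hx)
  have hand : ∀ S ⊆ α.extens,
      Form.bigAnd α'.1.form (k '' S) = (Form.bigAnd α.1.form S).rename k := fun S hS =>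
    Form.ext_holds fun v => by
      rw [holds_bigAnd_form hα' (himg S hS), Form.holds_rename, holds_bigAnd_form hα hS,
        Set.forall_mem_image]
      refine forall₂_congr fun x hx => ?_
      rw [h.form_eq x (hS hx).1, Form.holds_rename]
  have hψN := free_br_nodes hα hψ
  obtain ⟨S, hne, hS, rfl, hsat, hns, hmax⟩ := hψ
  refine ⟨k '' S, hne.image k, himg S hS, (hand S hS).symm, ?_, ?_, fun T hST hT hTs => ?_⟩
  · exact (hψN.sat_rename h.bijOn.injOn).2 hsat
  · rw [hst, ← Form.rename_not]
    exact (hψN.implies_rename (free_stuck hα).not h.bijOn.injOn).2 hns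
  · let T' : Set V := {x | x ∈ α.extens ∧ k x ∈ T}
    have hT' : k '' T' = T := by
      ext y
      constructor
      · rintro ⟨x, hx, rfl⟩
        exact hx.2
      · intro hy
        obtain ⟨x, hx, rfl⟩ := h.bijOn.surjOn (hT hy).1
        exact ⟨x, ⟨(hext x hx).1 (hT hy), hy⟩, rfl⟩
    have hsub : T' ⊆ α.extens := fun x hx => hx.1
    refine hmax T' ⟨fun x hx => ⟨hS hx, hST.1 ⟨x, hx, rfl⟩⟩, fun hTS => hST.2 ?_⟩ hsub ?_
    · rw [← hT']
      exact Set.image_mono hTS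
    · rw [← hT', hand T' hsub] at hTs
      obtain ⟨v, hv⟩ := hTs
      exact ⟨_, (Form.holds_rename _ _ _).1 hv⟩

theorem exists_rename_eq_of_mem_br {α' : LPO V L} {k : V → V} (h : IsoBy k α.1 α'.1)
    (hα : α.1.N.Finite) {ψ : Form V} (hψ : ψ ∈ α'.br) : ∃ χ ∈ α.br, χ.rename k = ψ := by
  have hα' : α'.1.N.Finite := by
    rw [← h.bijOn.image_eq]
    exact hα.image k
  obtain ⟨g, hg, e⟩ := exists_isoBy_symm h
  refine ⟨_, rename_mem_br hg hα' hψ, ?_⟩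
  rw [Form.rename_rename]
  refine (free_br_nodes hα' hψ).rename_eq_self fun y hy => ?_
  obtain ⟨x, hx, rfl⟩ := h.bijOn.surjOn hy
  exact congrArg k (e x hx)

end Branches

section Monotone

variable [PartialOrder L] [OrderBot L] {α α' : LPO V L}

/-- Extending `α` does not reach more valuations in a bottom node. -/
theorem Le.stuck_implies (h : Le α α') (hα' : α'.1.N.Finite) : α'.stuck.Implies α.stuck := by
  intro v hv
  rw [holds_stuck hα'] at hv
  rw [holds_stuck (hα'.subset h.subset)]
  obtain ⟨x, ⟨hx, hb⟩, hv⟩ := hv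
  by_cases hxα : x ∈ α.1.N
  · refine ⟨x, ⟨hxα, le_bot_iff.1 ((h.lab_le x hxα).trans hb.le)⟩, ?_⟩
    rwa [h.form_eq x hxα]
  · obtain ⟨z, hz, -, hzx⟩ := h.missing hx hxα
    exact ⟨z, hz, by rw [h.form_eq z hz.1]; exact α'.2.form_mono _ _ hzx v hv⟩

/-- A node that holds at a valuation which is not stuck in `α` is an extensible node of `α`. -/
theorem Le.mem_extens (h : Le α α') (hα' : α'.1.N.Finite) {x : V} (hx : x ∈ α'.1.N)
    {v : V → Bool} (hv : (α'.1.form x).Holds v) (hs : ¬ α.stuck.Holds v) : x ∈ α.extens := by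
  have hα := hα'.subset h.subset
  by_cases hxα : x ∈ α.1.N
  · exact ⟨hxα, fun hi => hs (hi v (by rwa [h.form_eq x hxα]))⟩
  · obtain ⟨z, hz, -, hzx⟩ := h.missing hx hxα
    refine (hs ((holds_stuck hα v).2 ⟨z, hz, ?_⟩)).elim
    rw [h.form_eq z hz.1]
    exact α'.2.form_mono _ _ hzx v hv

theorem Le.extens_subset (h : Le α α') (hα' : α'.1.N.Finite) : α.extens ⊆ α'.extens :=
  fun x hx => ⟨h.subset hx.1, fun hi => hx.2 fun v hv =>
    h.stuck_implies hα' v (hi v (by rwa [← h.form_eq x hx.1]))⟩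

theorem Le.bigAnd_eq (h : Le α α') (hα' : α'.1.N.Finite) {S : Set V} (hS : S ⊆ α.extens) :
    Form.bigAnd α.1.form S = Form.bigAnd α'.1.form S := Form.ext_holds fun v => by
  rw [holds_bigAnd_form (hα'.subset h.subset) hS,
    holds_bigAnd_form hα' (hS.trans (h.extens_subset hα'))]
  exact forall₂_congr fun x hx => by rw [h.form_eq x (hS hx).1]

/-- The branches of `α` exclude all that `α'` adds, and so they remain maximal. -/
theorem Le.br_subset (h : Le α α') (hα' : α'.1.N.Finite) : α.br ⊆ α'.br := by
  have hα := hα'.subset h.subset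
  rintro ψ ⟨S, hne, hS, rfl, hsat, hns, hmax⟩
  refine ⟨S, hne, hS.trans (h.extens_subset hα'), h.bigAnd_eq hα' hS, hsat, fun v hv => ?_, ?_⟩
  · exact (Form.holds_not _ _).2 fun hs =>
      (Form.holds_not _ _).1 (hns v hv) (h.stuck_implies hα' v hs)
  · rintro T hST hT ⟨v, hv⟩
    have hv' := (holds_bigAnd_form hα' hT v).1 hv
    have hvS : (Form.bigAnd α.1.form S).Holds v := (holds_bigAnd_form hα hS v).2 fun x hx => by
      rw [h.form_eq x (hS hx).1]
      exact hv' x (hST.1 hx)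
    have hT' : T ⊆ α.extens := fun x hx =>
      h.mem_extens hα' (hT hx).1 (hv' x hx) ((Form.holds_not _ _).1 (hns v hvS))
    exact hmax T hST hT' ⟨v, by rwa [h.bigAnd_eq hα' hT']⟩

/-- A new branch passes through a bottom node of `α`. Otherwise its maximality would make it
disagree with all bottom nodes of `α`, and it would be a branch of `α`. -/
theorem Le.exists_bot_of_mem_br (h : Le α α') (hα' : α'.1.N.Finite) {ψ : Form V}
    (hψ : ψ ∈ α'.br) (hn : ψ ∉ α.br) : ∃ z ∈ α.1.bots, ψ.Implies (α'.1.form z) := by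
  have hα := hα'.subset h.subset
  obtain ⟨S, hne, hS, rfl, hsat, hns, hmax⟩ := hψ
  by_contra hc
  have hS' : ∀ x ∈ S, (Form.bigAnd α'.1.form S).Implies (α'.1.form x) := fun x hx v hv =>
    (holds_bigAnd_form hα' hS v).1 hv x hx
  have hst : (Form.bigAnd α'.1.form S).Implies α.stuck.not := by
    intro v hv
    refine (Form.holds_not _ _).2 fun hs => ?_
    obtain ⟨z, hz, hzv⟩ := (holds_stuck hα v).1 hs
    rw [h.form_eq z hz.1] at hzv
    have hzS : z ∉ S := fun hzS => hc ⟨z, hz, hS' z hzS⟩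
    have hzext : z ∈ α'.extens := ⟨h.subset hz.1, fun hi =>
      (Form.holds_not _ _).1 (hns v hv) (hi v hzv)⟩
    have hins : insert z S ⊆ α'.extens := Set.insert_subset hzext hS
    refine hmax (insert z S) (Set.ssubset_insert hzS) hins
      ⟨v, (holds_bigAnd_form hα' hins v).2 fun x hx => ?_⟩
    rcases hx with rfl | hx
    · exact hzv
    · exact hS' x hx v hv
  obtain ⟨w, hw⟩ := hsat
  have hSα : S ⊆ α.extens := fun x hx =>
    h.mem_extens hα' (hS hx).1 (hS' x hx w hw) ((Form.holds_not _ _).1 (hst w hw))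
  refine hn ⟨S, hne, hSα, (h.bigAnd_eq hα' hSα).symm, ⟨w, hw⟩, hst, fun T hST hT hTs => ?_⟩
  rw [h.bigAnd_eq hα' hT] at hTs
  exact hmax T hST (hT.trans (h.extens_subset hα')) hTs

end Monotone

/-! ### Sequential composition -/

section Seq

variable [LE L] [OrderBot L] {α : LPO V L} {f : Form V → LPO V L}

/-- The node sets of `α` and of the `f ψ`, for the branches `ψ` of `α`, are disjoint. -/
def Apart (α : LPO V L) (f : Form V → LPO V L) : Prop :=
  ∀ ψ ∈ α.br, Disjoint (f ψ).1.N α.1.N ∧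
    ∀ ψ' ∈ α.br, ψ' ≠ ψ → Disjoint (f ψ).1.N (f ψ').1.N

theorem IsCopy.apart {β : LPO V L} (h : IsCopy α β f) : Apart α f := fun ψ hψ => (h ψ hψ).2

theorem Apart.notMem (h : Apart α f) {ψ : Form V} (hψ : ψ ∈ α.br) {x : V}
    (hx : x ∈ (f ψ).1.N) : x ∉ α.1.N := Set.disjoint_left.1 (h ψ hψ).1 hx

theorem Apart.unique (h : Apart α f) {ψ χ : Form V} (hψ : ψ ∈ α.br) (hχ : χ ∈ α.br) {x : V}
    (hx : x ∈ (f ψ).1.N) (hx' : x ∈ (f χ).1.N) : χ = ψ := by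
  by_contra hne
  exact Set.disjoint_left.1 ((h ψ hψ).2 χ hχ hne) hx hx'

theorem Apart.exists_choose (h : Apart α f) {ψ : Form V} (hψ : ψ ∈ α.br) {x : V}
    (hx : x ∈ (f ψ).1.N) : ∃ h : ∃ ψ ∈ α.br, x ∈ (f ψ).1.N, h.choose = ψ :=
  let H : ∃ ψ ∈ α.br, x ∈ (f ψ).1.N := ⟨ψ, hψ, hx⟩
  ⟨H, h.unique hψ H.choose_spec.1 hx H.choose_spec.2⟩

theorem seqAlong_lab_left {x : V} (hx : x ∈ α.1.N) : (α.seqAlong f).lab x = α.1.lab x :=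
  if_pos hx

theorem seqAlong_form_left {x : V} (hx : x ∈ α.1.N) : (α.seqAlong f).form x = α.1.form x :=
  if_pos hx

theorem Apart.lab_right (h : Apart α f) {ψ : Form V} (hψ : ψ ∈ α.br) {x : V}
    (hx : x ∈ (f ψ).1.N) : (α.seqAlong f).lab x = (f ψ).1.lab x := by
  obtain ⟨H, e⟩ := h.exists_choose hψ hx
  refine (if_neg (h.notMem hψ hx)).trans ((dif_pos H).trans ?_)
  rw [e]

theorem Apart.form_right (h : Apart α f) {ψ : Form V} (hψ : ψ ∈ α.br) {x : V}
    (hx : x ∈ (f ψ).1.N) : (α.seqAlong f).form x = ((f ψ).1.form x).and ψ := by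
  obtain ⟨H, e⟩ := h.exists_choose hψ hx
  refine (if_neg (h.notMem hψ hx)).trans ((dif_pos H).trans ?_)
  rw [e]

theorem Apart.lt_left (h : Apart α f) {x y : V} (hy : y ∈ α.1.N) :
    (α.seqAlong f).lt x y ↔ α.1.lt x y := by
  refine ⟨?_, Or.inl⟩
  rintro (e | ⟨ψ, hψ, e | ⟨-, -, e⟩⟩)
  · exact e
  · exact (h.notMem hψ ((f ψ).2.lt_mem _ _ e).2 hy).elim
  · exact (h.notMem hψ e hy).elim

theorem Apart.lt_right (h : Apart α f) {ψ : Form V} (hψ : ψ ∈ α.br) {x y : V}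
    (hy : y ∈ (f ψ).1.N) : (α.seqAlong f).lt x y ↔
      (f ψ).1.lt x y ∨ (x ∈ α.1.N ∧ ψ.Implies (α.1.form x)) := by
  constructor
  · rintro (e | ⟨χ, hχ, e | ⟨h1, h2, e⟩⟩)
    · exact (h.notMem hψ hy (α.2.lt_mem _ _ e).2).elim
    · rw [h.unique hψ hχ hy ((f χ).2.lt_mem _ _ e).2] at e
      exact Or.inl e
    · rw [h.unique hψ hχ hy e] at h2
      exact Or.inr ⟨h1, h2⟩
  · rintro (e | e)
    · exact Or.inr ⟨ψ, hψ, Or.inl e⟩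
    · exact Or.inr ⟨ψ, hψ, Or.inr ⟨e.1, e.2, hy⟩⟩

theorem seqAlong_finite (hα : α.1.N.Finite) (hf : ∀ ψ ∈ α.br, (f ψ).1.N.Finite) :
    (α.seqAlong f).N.Finite := by
  refine (hα.union ((br_finite hα).biUnion hf)).subset ?_
  rintro x (hx | ⟨ψ, hψ, hx⟩)
  · exact Or.inl hx
  · exact Or.inr (Set.mem_biUnion hψ hx)

theorem Apart.isLPO (h : Apart α f) (hα : α.1.N.Finite) (hf : ∀ ψ ∈ α.br, (f ψ).1.N.Finite) :
    (α.seqAlong f).IsLPO := by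
  have hfin := seqAlong_finite hα hf
  have hmem : ∀ {ψ}, ψ ∈ α.br → ∀ {x}, x ∈ (f ψ).1.N → x ∈ (α.seqAlong f).N :=
    fun {ψ} hψ {_} hx => Or.inr ⟨ψ, hψ, hx⟩
  have lt_mem : ∀ x y, (α.seqAlong f).lt x y → x ∈ (α.seqAlong f).N ∧ y ∈ (α.seqAlong f).N := by
    rintro x y (e | ⟨ψ, hψ, e | ⟨h1, h2, e⟩⟩)
    · exact (α.2.lt_mem _ _ e).imp Or.inl Or.inl
    · exact ((f ψ).2.lt_mem _ _ e).imp (hmem hψ) (hmem hψ)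
    · exact ⟨Or.inl h1, hmem hψ e⟩
  refine isLPO_of_root lt_mem ?_ ?_ hfin.countable ?_ ?_ (fun _ _ => hfin.subset fun y hy => hy.1)
    (fun _ => hfin.subset fun y hy => hy.1) ?_ ?_ ?_ ?_ ?_
  · exact fun x hx => (if_neg fun e => hx (Or.inl e)).trans (dif_neg fun e => hx (Or.inr e))
  · exact fun x hx => (if_neg fun e => hx (Or.inl e)).trans (dif_neg fun e => hx (Or.inr e))
  · intro x hxx
    rcases (lt_mem _ _ hxx).1 with hx | ⟨ψ, hψ, hx⟩
    · exact α.2.irrefl x ((h.lt_left hx).1 hxx)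
    · rcases (h.lt_right hψ hx).1 hxx with e | e
      · exact (f ψ).2.irrefl x e
      · exact h.notMem hψ hx e.1
  · intro x y z hxy hyz
    rcases (lt_mem _ _ hyz).2 with hz | ⟨ψ, hψ, hz⟩
    · rw [h.lt_left hz] at hyz ⊢
      rw [h.lt_left (α.2.lt_mem _ _ hyz).1] at hxy
      exact α.2.trans _ _ _ hxy hyz
    · rw [h.lt_right hψ hz] at hyz ⊢
      rcases hyz with e | ⟨hy, hi⟩
      · rw [h.lt_right hψ ((f ψ).2.lt_mem _ _ e).1] at hxy
        exact hxy.imp (fun e' => (f ψ).2.trans _ _ _ e' e) id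
      · rw [h.lt_left hy] at hxy
        exact Or.inr ⟨(α.2.lt_mem _ _ hxy).1, fun v hv => α.2.form_mono _ _ hxy v (hi v hv)⟩
  · obtain ⟨r, hr, hle⟩ := α.exists_root_le
    refine ⟨r, Or.inl hr, ?_⟩
    rintro x (hx | ⟨ψ, hψ, hx⟩)
    · exact (hle x hx).imp id (h.lt_left hx).2
    · obtain ⟨y, hy, hi⟩ := exists_implies_of_mem_br hα hψ
      refine Or.inr ((h.lt_right hψ hx).2 (Or.inr ⟨hr, fun v hv => ?_⟩))
      rcases hle y hy with rfl | e
      · exact hi v hv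
      · exact α.2.form_mono _ _ e v (hi v hv)
  · intro x hx hb y hxy
    rcases (lt_mem _ _ hxy).2 with hy | ⟨ψ, hψ, hy⟩
    · rw [h.lt_left hy] at hxy
      have hxα := (α.2.lt_mem _ _ hxy).1
      rw [seqAlong_lab_left hxα] at hb
      exact α.not_lt_of_bot ⟨hxα, hb⟩ hxy
    · rcases (h.lt_right hψ hy).1 hxy with e | ⟨hxα, hi⟩
      · have hxf := ((f ψ).2.lt_mem _ _ e).1
        rw [h.lab_right hψ hxf] at hb
        exact (f ψ).not_lt_of_bot ⟨hxf, hb⟩ e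
      · rw [seqAlong_lab_left hxα] at hb
        exact not_implies_bot hα hψ ⟨hxα, hb⟩ hi
  · rintro x (hx | ⟨ψ, hψ, hx⟩)
    · rw [seqAlong_form_left hx]
      exact α.2.sat x hx
    · rw [h.form_right hψ hx]
      exact ((f ψ).free_nodes hx).sat_and (free_br_nodes hα hψ) (h ψ hψ).1 ((f ψ).2.sat x hx)
        (sat_of_mem_br hψ)
  · rintro x (hx | ⟨ψ, hψ, hx⟩)
    · rw [seqAlong_form_left hx]
      exact (α.2.free x hx).mono fun y hy => ⟨Or.inl hy.1, (h.lt_left hx).2 hy.2⟩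
    · rw [h.form_right hψ hx]
      refine Form.FreeIn.and (((f ψ).2.free x hx).mono fun y hy => ?_)
        ((free_br hα hψ).mono fun y hy => ?_)
      · exact ⟨hmem hψ hy.1, (h.lt_right hψ hx).2 (Or.inl hy.2)⟩
      · exact ⟨Or.inl hy.1, (h.lt_right hψ hx).2 (Or.inr hy)⟩
  · intro x y hxy
    rcases (lt_mem _ _ hxy).2 with hy | ⟨ψ, hψ, hy⟩
    · rw [h.lt_left hy] at hxy
      rw [seqAlong_form_left hy, seqAlong_form_left (α.2.lt_mem _ _ hxy).1]
      exact α.2.form_mono _ _ hxy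
    · rw [h.form_right hψ hy]
      intro v hv
      rw [Form.holds_and] at hv
      rcases (h.lt_right hψ hy).1 hxy with e | ⟨hxα, hi⟩
      · rw [h.form_right hψ ((f ψ).2.lt_mem _ _ e).1, Form.holds_and]
        exact ⟨(f ψ).2.form_mono _ _ e v hv.1, hv.2⟩
      · rw [seqAlong_form_left hxα]
        exact hi v hv.2

/-- Isomorphisms of the components combine to an isomorphism of the compositions. -/
theorem isoBy_seqAlong {α' : LPO V L} {f' : Form V → LPO V L} {k : V → V}
    (hα : α.1.N.Finite) (h : Apart α f) (h' : Apart α' f') (hk : IsoBy k α.1 α'.1)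
    (hkf : ∀ ψ ∈ α.br, IsoBy k (f ψ).1 (f' (ψ.rename k)).1) :
    IsoBy k (α.seqAlong f) (α'.seqAlong f') := by
  obtain ⟨r, hr, -⟩ := α.exists_root_le
  have : Nonempty V := ⟨r⟩
  have hbr : ∀ {ψ}, ψ ∈ α.br → ψ.rename k ∈ α'.br := fun hψ => rename_mem_br hk hα hψ
  have hne : ∀ {ψ χ}, ψ ∈ α.br → χ ∈ α.br → ψ.rename k = χ.rename k → ψ = χ := fun hψ hχ e =>
    (free_br_nodes hα hψ).rename_injective (free_br_nodes hα hχ) hk.bijOn.injOn e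
  have hmα : ∀ {x}, x ∈ α.1.N → k x ∈ α'.1.N := fun hx => hk.bijOn.mapsTo hx
  have hmf : ∀ {ψ x}, ψ ∈ α.br → x ∈ (f ψ).1.N → k x ∈ (f' (ψ.rename k)).1.N :=
    fun hψ hx => (hkf _ hψ).bijOn.mapsTo hx
  have hcross : ∀ {ψ x}, ψ ∈ α.br → x ∈ (f ψ).1.N → k x ∉ α'.1.N :=
    fun hψ hx => h'.notMem (hbr hψ) (hmf hψ hx)
  have hsame : ∀ {ψ χ x}, ψ ∈ α.br → χ ∈ α.br → x ∈ (f χ).1.N → k x ∈ (f' (ψ.rename k)).1.N →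
      χ = ψ := fun hψ hχ hx hx' => hne hχ hψ (h'.unique (hbr hψ) (hbr hχ) hx' (hmf hχ hx))
  refine ⟨⟨?_, ?_, ?_⟩, ?_, ?_, ?_⟩
  · rintro x (hx | ⟨ψ, hψ, hx⟩)
    · exact Or.inl (hmα hx)
    · exact Or.inr ⟨_, hbr hψ, hmf hψ hx⟩
  · rintro x (hx | ⟨ψ, hψ, hx⟩) y (hy | ⟨χ, hχ, hy⟩) hxy
    · exact hk.bijOn.injOn hx hy hxy
    · exact (hcross hχ hy (hxy ▸ hmα hx)).elim
    · exact (hcross hψ hx (hxy ▸ hmα hy)).elim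
    · obtain rfl := hsame hψ hχ hy (hxy ▸ hmf hψ hx)
      exact (hkf _ hχ).bijOn.injOn hx hy hxy
  · rintro y (hy | ⟨ψ, hψ, hy⟩)
    · obtain ⟨x, hx, rfl⟩ := hk.bijOn.surjOn hy
      exact ⟨x, Or.inl hx, rfl⟩
    · obtain ⟨χ, hχ, rfl⟩ := exists_rename_eq_of_mem_br hk hα hψ
      obtain ⟨x, hx, rfl⟩ := (hkf χ hχ).bijOn.surjOn hy
      exact ⟨x, Or.inr ⟨χ, hχ, hx⟩, rfl⟩
  · rintro x hx y (hy | ⟨ψ, hψ, hy⟩)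
    · rw [h'.lt_left (hmα hy), h.lt_left hy]
      rcases hx with hx | ⟨χ, hχ, hx⟩
      · exact hk.lt_iff x hx y hy
      · exact iff_of_false (fun e => hcross hχ hx (α'.2.lt_mem _ _ e).1)
          fun e => h.notMem hχ hx (α.2.lt_mem _ _ e).1
    · rw [h'.lt_right (hbr hψ) (hmf hψ hy), h.lt_right hψ hy]
      rcases hx with hx | ⟨χ, hχ, hx⟩
      · refine or_congr (iff_of_false (fun e => ?_) fun e => ?_)
          (and_congr (iff_of_true (hmα hx) hx) ?_)
        · exact h'.notMem (hbr hψ) ((f' _).2.lt_mem _ _ e).1 (hmα hx)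
        · exact h.notMem hψ ((f ψ).2.lt_mem _ _ e).1 hx
        · rw [hk.form_eq x hx, (free_br_nodes hα hψ).implies_rename (α.free_nodes hx)
            hk.bijOn.injOn]
      · refine or_congr ?_ (iff_of_false (fun e => hcross hχ hx e.1) fun e => h.notMem hχ hx e.1)
        by_cases e : χ = ψ
        · subst e
          exact (hkf χ hχ).lt_iff x hx y hy
        · refine iff_of_false (fun e' => e ?_) fun e' => e ?_
          · exact hsame hψ hχ hx ((f' _).2.lt_mem _ _ e').1
          · exact h.unique hψ hχ ((f ψ).2.lt_mem _ _ e').1 hx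
  · rintro x (hx | ⟨ψ, hψ, hx⟩)
    · rw [seqAlong_lab_left hx, seqAlong_lab_left (hmα hx), hk.lab_eq x hx]
    · rw [h.lab_right hψ hx, h'.lab_right (hbr hψ) (hmf hψ hx), (hkf ψ hψ).lab_eq x hx]
  · rintro x (hx | ⟨ψ, hψ, hx⟩)
    · rw [seqAlong_form_left hx, seqAlong_form_left (hmα hx), hk.form_eq x hx]
    · rw [h.form_right hψ hx, h'.form_right (hbr hψ) (hmf hψ hx), (hkf ψ hψ).form_eq x hx]
      exact Form.ext_holds fun v => by simp

/-- There is room for the copies, since the composition is finite. -/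
theorem exists_isCopy [Infinite V] (β : LPO V L) (hα : α.1.N.Finite) :
    ∃ f, IsCopy α β f := by
  have : Infinite ↥(α.1.N)ᶜ := hα.infinite_compl.to_subtype
  let e : ℕ × ℕ → V := fun p => (Infinite.natEmbedding ↥(α.1.N)ᶜ (Nat.pairEquiv p)).1
  have he : Function.Injective e := fun p q h =>
    Nat.pairEquiv.injective ((Infinite.natEmbedding _).injective (Subtype.ext h))
  have he' : ∀ p, e p ∉ α.1.N := fun p =>
    (Infinite.natEmbedding ↥(α.1.N)ᶜ (Nat.pairEquiv p)).2
  obtain ⟨c, hc⟩ := Set.countable_iff_exists_injOn.1 β.2.countable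
  obtain ⟨d, hd⟩ := Set.countable_iff_exists_injOn.1 (br_finite hα).countable
  have hinj : ∀ ψ, Set.InjOn (fun x => e (d ψ, c x)) β.1.N := fun ψ x hx y hy h =>
    hc hx hy (congrArg Prod.snd (he h))
  refine ⟨fun ψ => β.map _ (hinj ψ), fun ψ hψ => ⟨iso_iff.2 ⟨_, β.isoBy_map _⟩, ?_, ?_⟩⟩
  · refine Set.disjoint_left.2 ?_
    rintro _ ⟨x, -, rfl⟩
    exact he' _
  · refine fun ψ' hψ' hne => Set.disjoint_left.2 ?_
    rintro _ ⟨x, -, rfl⟩ ⟨y, -, h⟩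
    exact hne (hd hψ' hψ (congrArg Prod.fst (he h)))

theorem IsCopy.finite {β : LPO V L} (h : IsCopy α β f) (hβ : β.1.N.Finite) :
    ∀ ψ ∈ α.br, (f ψ).1.N.Finite := fun ψ hψ => finite_of_mem_cls hβ (h ψ hψ).1

/-- The composition of `α` with copies of `β`. -/
noncomputable def IsCopy.seq {β : LPO V L} (h : IsCopy α β f) (hα : α.1.N.Finite)
    (hβ : β.1.N.Finite) : LPO V L :=
  ⟨α.seqAlong f, h.apart.isLPO hα (h.finite hβ)⟩

/-- The isomorphism class of the composition depends only on those of the components. -/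
theorem IsCopy.iso_seq {α' β β' : LPO V L} {f' : Form V → LPO V L} (h : IsCopy α β f)
    (h' : IsCopy α' β' f') (hα : α.1.N.Finite) (hβ : β.1.N.Finite) (hα' : α'.1.N.Finite)
    (hβ' : β'.1.N.Finite) (hiα : Iso α α') (hiβ : Iso β β') :
    Iso (h.seq hα hβ) (h'.seq hα' hβ') := by
  classical
  obtain ⟨g, hg⟩ := iso_iff.1 hiα
  have hcopy : ∀ ψ, ψ ∈ α.br → ∃ j, IsoBy j (f ψ).1 (f' (ψ.rename g)).1 := fun ψ hψ =>
    iso_iff.1 ((h ψ hψ).1.symm.trans (hiβ.trans (h' _ (rename_mem_br hg hα hψ)).1))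
  obtain ⟨r, -⟩ := α.exists_root_le
  have : Nonempty V := ⟨r⟩
  choose! j hj using hcopy
  let k : V → V := fun x => if x ∈ α.1.N then g x else
    if H : ∃ ψ ∈ α.br, x ∈ (f ψ).1.N then j H.choose x else x
  have hkα : ∀ x ∈ α.1.N, g x = k x := fun x hx => (if_pos hx).symm
  have hkf : ∀ ψ ∈ α.br, ∀ x ∈ (f ψ).1.N, j ψ x = k x := fun ψ hψ x hx => by
    obtain ⟨H, e⟩ := h.apart.exists_choose hψ hx
    refine Eq.symm ((if_neg (h.apart.notMem hψ hx)).trans ((dif_pos H).trans ?_))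
    rw [e]
  have hk := hg.congr (fun x hx => α.free_nodes hx) hkα
  refine iso_iff.2 ⟨k, isoBy_seqAlong hα h.apart h'.apart hk fun ψ hψ => ?_⟩
  rw [← (free_br_nodes hα hψ).rename_congr hkα]
  exact (hj ψ hψ).congr (fun x hx => (f ψ).free_nodes hx) (hkf ψ hψ)

/-- Any tuple isomorphic to a composition is itself a composition. -/
theorem IsCopy.exists_of_isoBy {β δ : LPO V L} {k : V → V} (h : IsCopy α β f)
    (hα : α.1.N.Finite) (hβ : β.1.N.Finite) (hk : IsoBy k (α.seqAlong f) δ.1) :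
    ∃ α' f', Iso α α' ∧ IsCopy α' β f' ∧ δ.1 = α'.seqAlong f' := by
  classical
  obtain ⟨r, hr, -⟩ := α.exists_root_le
  have : Nonempty V := ⟨r⟩
  have hinj := hk.bijOn.injOn
  have hiα : Set.InjOn k α.1.N := hinj.mono fun x hx => Or.inl hx
  have hif : ∀ ψ, ψ ∈ α.br → Set.InjOn k (f ψ).1.N := fun ψ hψ =>
    hinj.mono fun x hx => Or.inr ⟨ψ, hψ, hx⟩
  let α' := α.map k hiα
  have hα' : IsoBy k α.1 α'.1 := α.isoBy_map hiα
  let f' : Form V → LPO V L := fun χ =>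
    if H : ∃ ψ ∈ α.br, ψ.rename k = χ then (f H.choose).map k (hif _ H.choose_spec.1) else α
  have hf' : ∀ ψ (hψ : ψ ∈ α.br), f' (ψ.rename k) = (f ψ).map k (hif ψ hψ) := by
    intro ψ hψ
    have H : ∃ χ ∈ α.br, χ.rename k = ψ.rename k := ⟨ψ, hψ, rfl⟩
    have e : H.choose = ψ := (free_br_nodes hα H.choose_spec.1).rename_injective
      (free_br_nodes hα hψ) hiα H.choose_spec.2
    refine (dif_pos H).trans ?_
    congr 2
  have hkf : ∀ ψ ∈ α.br, IsoBy k (f ψ).1 (f' (ψ.rename k)).1 := fun ψ hψ => by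
    rw [hf' ψ hψ]
    exact (f ψ).isoBy_map _
  have hdisj : ∀ {S T : Set V}, S ⊆ (α.seqAlong f).N → T ⊆ (α.seqAlong f).N → Disjoint S T →
      Disjoint (k '' S) (k '' T) := by
    intro S T hS hT hST
    refine Set.disjoint_left.2 ?_
    rintro _ ⟨x, hx, rfl⟩ ⟨y, hy, e⟩
    exact Set.disjoint_left.1 hST hx (hinj (hT hy) (hS hx) e ▸ hy)
  have hcopy : IsCopy α' β f' := by
    intro χ hχ
    obtain ⟨ψ, hψ, rfl⟩ := exists_rename_eq_of_mem_br hα' hα hχ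
    refine ⟨(h ψ hψ).1.trans (iso_iff.2 ⟨k, hkf ψ hψ⟩), ?_, fun χ' hχ' hne => ?_⟩
    · rw [← (hkf ψ hψ).bijOn.image_eq, ← hα'.bijOn.image_eq]
      exact hdisj (fun x hx => Or.inr ⟨ψ, hψ, hx⟩) (fun x hx => Or.inl hx) (h ψ hψ).2.1
    · obtain ⟨ψ', hψ', rfl⟩ := exists_rename_eq_of_mem_br hα' hα hχ'
      rw [← (hkf ψ hψ).bijOn.image_eq, ← (hkf ψ' hψ').bijOn.image_eq]
      exact hdisj (fun x hx => Or.inr ⟨ψ, hψ, hx⟩) (fun x hx => Or.inr ⟨ψ', hψ', hx⟩)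
        ((h ψ hψ).2.2 ψ' hψ' fun e => hne (by rw [e]))
  have hiso := isoBy_seqAlong hα h.apart hcopy.apart hα' hkf
  refine ⟨α', f', iso_iff.2 ⟨k, hα'⟩, hcopy, ?_⟩
  exact congrArg Subtype.val (eq_of_isoBy hk (γ := hcopy.seq (hα.image k) hβ) hiso)

end Seq

/-- Composition is monotone. New nodes of the first component lie above its bottom nodes, those
of the copies above bottom nodes of copies, and a copy for a new branch above the bottom node
given by `Le.exists_bot_of_mem_br`. -/
theorem Le.seqAlong_le [PartialOrder L] [OrderBot L] {α α' : LPO V L} {f f' : Form V → LPO V L}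
    (hle : Le α α') (hf : ∀ ψ ∈ α.br, Le (f ψ) (f' ψ)) (hα' : α'.1.N.Finite) (h : Apart α f)
    (h' : Apart α' f') {δ δ' : LPO V L} (hδ : δ.1 = α.seqAlong f) (hδ' : δ'.1 = α'.seqAlong f') :
    Le δ δ' := by
  have hα := hα'.subset hle.subset
  have hbr := hle.br_subset hα'
  refine le_of_missing ?_ ?_ ?_ ?_ ?_ ?_ <;> rw [hδ, hδ']
  · rintro x (hx | ⟨ψ, hψ, hx⟩)
    · exact Or.inl (hle.subset hx)
    · exact Or.inr ⟨ψ, hbr hψ, (hf ψ hψ).subset hx⟩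
  · rintro x (hx | ⟨ψ, hψ, hx⟩) y hyx
    · rw [h'.lt_left (hle.subset hx)] at hyx
      exact Or.inl (hle.down_closed x hx ⟨(α'.2.lt_mem _ _ hyx).1, hyx⟩)
    · rw [h'.lt_right (hbr hψ) ((hf ψ hψ).subset hx)] at hyx
      rcases hyx with e | ⟨hy, hi⟩
      · exact Or.inr ⟨ψ, hψ, (hf ψ hψ).down_closed x hx ⟨((f' ψ).2.lt_mem _ _ e).1, e⟩⟩
      · refine Or.inl ?_
        by_contra hn
        obtain ⟨z, hz, -, hzy⟩ := hle.missing hy hn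
        refine not_implies_bot hα hψ hz fun v hv => ?_
        rw [hle.form_eq z hz.1]
        exact α'.2.form_mono _ _ hzy v (hi v hv)
  · rintro x hx y (hy | ⟨ψ, hψ, hy⟩)
    · rw [h'.lt_left (hle.subset hy), h.lt_left hy, hle.lt_iff]
      refine ⟨fun e => ⟨e, ?_, hy⟩, fun e => e.1⟩
      exact hle.down_closed y hy ⟨(α'.2.lt_mem _ _ e).1, e⟩
    · rw [h'.lt_right (hbr hψ) ((hf ψ hψ).subset hy), h.lt_right hψ hy, (hf ψ hψ).lt_iff]
      refine or_congr ⟨fun e => ⟨e, ?_, hy⟩, fun e => e.1⟩ ⟨fun e => ?_, fun e => ?_⟩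
      · exact (hf ψ hψ).down_closed y hy ⟨((f' ψ).2.lt_mem _ _ e).1, e⟩
      · rcases hx with hx | ⟨χ, hχ, hx⟩
        · exact ⟨hx, by rw [hle.form_eq x hx]; exact e.2⟩
        · exact (h'.notMem (hbr hχ) ((hf χ hχ).subset hx) e.1).elim
      · exact ⟨hle.subset e.1, by rw [← hle.form_eq x e.1]; exact e.2⟩
  · rintro x (hx | ⟨ψ, hψ, hx⟩)
    · rw [seqAlong_lab_left hx, seqAlong_lab_left (hle.subset hx)]
      exact hle.lab_le x hx
    · rw [h.lab_right hψ hx, h'.lab_right (hbr hψ) ((hf ψ hψ).subset hx)]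
      exact (hf ψ hψ).lab_le x hx
  · rintro x (hx | ⟨ψ, hψ, hx⟩)
    · rw [seqAlong_form_left hx, seqAlong_form_left (hle.subset hx)]
      exact hle.form_eq x hx
    · rw [h.form_right hψ hx, h'.form_right (hbr hψ) ((hf ψ hψ).subset hx),
        (hf ψ hψ).form_eq x hx]
  · have hbots : α.1.bots ⊆ (α.seqAlong f).bots := fun z hz =>
      ⟨Or.inl hz.1, (seqAlong_lab_left hz.1).trans hz.2⟩
    rintro y (hy | ⟨ψ, hψ, hy⟩) hn
    · obtain ⟨z, hz, -, hzy⟩ := hle.missing hy fun hyα => hn (Or.inl hyα)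
      exact ⟨z, hbots hz, (h'.lt_left hy).2 hzy⟩
    · by_cases hψα : ψ ∈ α.br
      · obtain ⟨z, hz, -, hzy⟩ := (hf ψ hψα).missing hy fun hyf => hn (Or.inr ⟨ψ, hψα, hyf⟩)
        exact ⟨z, ⟨Or.inr ⟨ψ, hψα, hz.1⟩, (h.lab_right hψα hz.1).trans hz.2⟩,
          (h'.lt_right hψ hy).2 (Or.inl hzy)⟩
      · obtain ⟨z, hz, hi⟩ := hle.exists_bot_of_mem_br hα' hψ hψα
        exact ⟨z, hbots hz, (h'.lt_right hψ hy).2 (Or.inr ⟨hle.subset hz.1, hi⟩)⟩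

end LPO

section FinPomsets

open PreLPO LPO

variable {V L : Type*} [PartialOrder L] [OrderBot L]

/-- The compositions of representatives form a finite pomset. -/
theorem FinPom.exists_seq [Infinite V] (A B : FinPom V L) :
    ∃ C : FinPom V L, Subtype.val '' C.1.1 = FinPom.seqSet A B := by
  obtain ⟨α, hα⟩ := A.1.exists_mem
  obtain ⟨β, hβ⟩ := B.1.exists_mem
  have hαf := A.2 α hα
  have hβf := B.2 β hβ
  obtain ⟨f, hf⟩ := exists_isCopy β hαf
  refine ⟨fcls (hf.seq hαf hβf) (seqAlong_finite hαf (hf.finite hβf)), ?_⟩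
  ext δ
  constructor
  · rintro ⟨δ, hδ, rfl⟩
    obtain ⟨k, hk⟩ := iso_iff.1 hδ
    obtain ⟨α', f', hi, hf', e⟩ := hf.exists_of_isoBy hαf hβf hk
    refine ⟨α', ?_, β, hβ, f', hf', e⟩
    rw [eq_cls_of_mem hα]
    exact hi
  · rintro ⟨α', hα', β', hβ', f', hf', rfl⟩
    refine ⟨hf'.seq (A.2 α' hα') (B.2 β' hβ'), ?_, rfl⟩
    rw [eq_cls_of_mem hα] at hα'
    rw [eq_cls_of_mem hβ] at hβ'
    exact hf.iso_seq hf' hαf hβf _ _ hα' hβ'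

theorem FinPom.seq_mono [Infinite V] {A A' B B' C C' : FinPom V L}
    (hC : Subtype.val '' C.1.1 = FinPom.seqSet A B)
    (hC' : Subtype.val '' C'.1.1 = FinPom.seqSet A' B') (hA : A ≤ A') (hB : B ≤ B') : C ≤ C' := by
  intro δ' hδ'
  obtain ⟨α', hα', β', hβ', f', hf', e'⟩ :
      δ'.1 ∈ FinPom.seqSet A' B' := hC' ▸ ⟨δ', hδ', rfl⟩
  obtain ⟨α, hα, hle⟩ := hA α' hα'
  obtain ⟨β, hβ⟩ := B.1.exists_mem
  have hbr := hle.br_subset (A'.2 α' hα')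
  have hf : ∀ ψ, ∃ γ ∈ B.1.1, ψ ∈ α.br → Le γ (f' ψ) := by
    intro ψ
    by_cases hψ : ψ ∈ α.br
    · have hm : f' ψ ∈ B'.1.1 := by
        rw [eq_cls_of_mem hβ']
        exact (hf' ψ (hbr hψ)).1
      obtain ⟨γ, hγ, hγle⟩ := hB _ hm
      exact ⟨γ, hγ, fun _ => hγle⟩
    · exact ⟨β, hβ, fun h => (hψ h).elim⟩
  choose f hfB hfle using hf
  have hcopy : IsCopy α β f := by
    refine fun ψ hψ => ⟨?_, ?_, fun ψ' hψ' hne => ?_⟩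
    · have := hfB ψ
      rwa [eq_cls_of_mem hβ] at this
    · exact (hf' ψ (hbr hψ)).2.1.mono (hfle ψ hψ).subset hle.subset
    · exact ((hf' ψ (hbr hψ)).2.2 ψ' (hbr hψ') hne).mono (hfle ψ hψ).subset (hfle ψ' hψ').subset
  obtain ⟨δ, hδ, e⟩ : α.seqAlong f ∈ Subtype.val '' C.1.1 :=
    hC ▸ ⟨α, hα, β, hβ, f, hcopy, rfl⟩
  exact ⟨δ, hδ, hle.seqAlong_le hfle (A'.2 α' hα') hcopy.apart hf'.apart e e'⟩

/-- If all nodes of `A` are bottom nodes then `A` has no branches, and so composing has no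
effect. -/
theorem FinPom.isBot_seq {A B C : FinPom V L} (hC : Subtype.val '' C.1.1 = FinPom.seqSet A B)
    (hA : ∀ α ∈ A.1.1, ∀ x ∈ α.1.N, α.1.lab x = ⊥) : IsBot C.1 := by
  obtain ⟨δ, hδ⟩ := C.1.exists_mem
  obtain ⟨α, hα, β, hβ, f, hf, e⟩ : δ.1 ∈ FinPom.seqSet A B := hC ▸ ⟨δ, hδ, rfl⟩
  have hbr : ∀ ψ, ψ ∉ α.br := by
    rintro ψ ⟨S, ⟨x, hx⟩, hS, -⟩
    refine (hS hx).2 fun v hv => (holds_stuck (A.2 α hα) v).2 ⟨x, ⟨(hS hx).1, ?_⟩, hv⟩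
    exact hA α hα x (hS hx).1
  rw [eq_cls_of_mem hδ]
  refine isBot_cls_of_lab_eq_bot ?_
  rw [e]
  rintro x (hx | ⟨ψ, hψ, -⟩)
  · rw [seqAlong_lab_left hx]
    exact hA α hα x hx
  · exact (hbr ψ hψ).elim

end FinPomsets

end Pomset

/-! ### Composition of arbitrary pomsets -/

theorem mainTheorem6 {V L : Type*} [Infinite V] [PartialOrder L] [OrderBot L]
    (hdcpo : ∀ D : Set L, D.Nonempty → DirectedOn (· ≤ ·) D → ∃ l, IsLUB D l)
    (hfp : ∀ l : L, (Set.Iio l).Finite) :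
    -- pomsets form a partial order in which every directed set has a supremum
    (∀ A B : Pomset.Pom V L, A ≤ B → B ≤ A → A = B) ∧
    (∀ D : Set (Pomset.Pom V L), DirectedOn (· ≤ ·) D → ∃ S, IsLUB D S) ∧
    -- composition of finite pomsets is well defined
    ∃ seqFin : Pomset.FinPom V L → Pomset.FinPom V L → Pomset.FinPom V L,
      (∀ A B, Subtype.val '' (seqFin A B).1.1 = Pomset.FinPom.seqSet A B) ∧
      -- it is monotone
      (∀ A A' B B', A ≤ A' → B ≤ B' → seqFin A B ≤ seqFin A' B') ∧
      -- the iterated suprema that define its extension to all pomsets exist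
      ∃ seq : Pomset.Pom V L → Pomset.Pom V L → Pomset.Pom V L,
        (∀ A B, ∃ g : Pomset.FinPom V L → Pomset.Pom V L,
          (∀ A' : Pomset.FinPom V L, A'.1 ≤ A →
            IsLUB {C | ∃ B' : Pomset.FinPom V L, B'.1 ≤ B ∧ C = (seqFin A' B').1} (g A')) ∧
          IsLUB {C | ∃ A' : Pomset.FinPom V L, A'.1 ≤ A ∧ C = g A'} (seq A B)) ∧
        (∀ A B : Pomset.FinPom V L, seq A.1 B.1 = (seqFin A B).1) ∧
        -- the extension is Scott continuous, and preserves the supremum of the empty set too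
        ScottContinuous (fun p : Pomset.Pom V L × Pomset.Pom V L => seq p.1 p.2) ∧
        (∀ A B, IsBot A → IsBot B → IsBot (seq A B)) := by
  have := Pomset.wellFoundedGT_of_directed hdcpo hfp
  refine ⟨fun A B => Pomset.Pom.le_antisymm, fun D => Pomset.Pom.exists_isLUB, ?_⟩
  choose seqFin hseqFin using Pomset.FinPom.exists_seq (V := V) (L := L)
  have hmono : ∀ A A' B B', A ≤ A' → B ≤ B' → seqFin A B ≤ seqFin A' B' :=
    fun A A' B B' => Pomset.FinPom.seq_mono (hseqFin A B) (hseqFin A' B')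
  refine ⟨seqFin, hseqFin, hmono, ?_⟩
  have hinner : ∀ (A' : Pomset.FinPom V L) (B : Pomset.Pom V L), ∃ C,
      IsLUB {C | ∃ B' : Pomset.FinPom V L, B'.1 ≤ B ∧ C = (seqFin A' B').1} C := by
    refine fun A' B => Pomset.Pom.exists_isLUB ?_
    rintro _ ⟨B₁, h₁, rfl⟩ _ ⟨B₂, h₂, rfl⟩
    obtain ⟨B₃, h₃, h₁₃, h₂₃⟩ := Pomset.FinPom.exists_le_le h₁ h₂
    exact ⟨_, ⟨B₃, h₃, rfl⟩, hmono _ _ _ _ le_rfl h₁₃, hmono _ _ _ _ le_rfl h₂₃⟩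
  choose g hg using hinner
  have hgmono : ∀ {A₁ A₂ : Pomset.FinPom V L} (B : Pomset.Pom V L), A₁ ≤ A₂ → g A₁ B ≤ g A₂ B := by
    intro A₁ A₂ B h
    refine (hg A₁ B).2 ?_
    rintro _ ⟨B', hB', rfl⟩
    exact le_trans (hmono _ _ _ _ h le_rfl) ((hg A₂ B).1 ⟨B', hB', rfl⟩)
  have houter : ∀ A B : Pomset.Pom V L, ∃ C,
      IsLUB {C | ∃ A' : Pomset.FinPom V L, A'.1 ≤ A ∧ C = g A' B} C := by
    refine fun A B => Pomset.Pom.exists_isLUB ?_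
    rintro _ ⟨A₁, h₁, rfl⟩ _ ⟨A₂, h₂, rfl⟩
    obtain ⟨A₃, h₃, h₁₃, h₂₃⟩ := Pomset.FinPom.exists_le_le h₁ h₂
    exact ⟨_, ⟨A₃, h₃, rfl⟩, hgmono B h₁₃, hgmono B h₂₃⟩
  choose seq hseq using houter
  have hle : ∀ {A B U : Pomset.Pom V L}, seq A B ≤ U ↔
      ∀ A' B' : Pomset.FinPom V L, A'.1 ≤ A → B'.1 ≤ B → (seqFin A' B').1 ≤ U := by
    intro A B U
    constructor
    · intro h A' B' hA' hB'
      exact ((hg A' B).1 ⟨B', hB', rfl⟩).trans (((hseq A B).1 ⟨A', hA', rfl⟩).trans h)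
    · intro h
      refine (hseq A B).2 ?_
      rintro _ ⟨A', hA', rfl⟩
      refine (hg A' B).2 ?_
      rintro _ ⟨B', hB', rfl⟩
      exact h A' B' hA' hB'
  have hfin : ∀ A B : Pomset.FinPom V L, seq A.1 B.1 = (seqFin A B).1 := fun A B =>
    Pomset.Pom.le_antisymm (hle.2 fun A' B' hA' hB' => hmono _ _ _ _ hA' hB')
      (hle.1 le_rfl A B le_rfl le_rfl)
  refine ⟨seq, fun A B => ⟨fun A' => g A' B, fun A' _ => hg A' B, hseq A B⟩, hfin, ?_, ?_⟩
  · intro D hne hD p hp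
    obtain ⟨hp₁, hp₂⟩ := isLUB_prod.1 hp
    constructor
    · rintro _ ⟨q, hq, rfl⟩
      exact hle.2 fun A' B' hA' hB' => hle.1 le_rfl A' B'
        (hA'.trans (hp.1 hq).1) (hB'.trans (hp.1 hq).2)
    · intro U hU
      refine hle.2 fun A' B' hA' hB' => ?_
      -- both finite factors lie below one member of `D`, by compactness
      obtain ⟨_, ⟨q₁, hq₁, rfl⟩, h₁⟩ := Pomset.FinPom.exists_le_of_isLUB (hne.image _)
        (hD.mono_comp fun _ _ h => h.1) hp₁ hA'
      obtain ⟨_, ⟨q₂, hq₂, rfl⟩, h₂⟩ := Pomset.FinPom.exists_le_of_isLUB (hne.image _)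
        (hD.mono_comp fun _ _ h => h.2) hp₂ hB'
      obtain ⟨q, hq, hq₁q, hq₂q⟩ := hD q₁ hq₁ q₂ hq₂
      exact hle.1 (hU ⟨q, hq, rfl⟩) A' B' (h₁.trans hq₁q.1) (h₂.trans hq₂q.2)
  · intro A B hA hB
    obtain ⟨α, hα, hb⟩ := Pomset.LPO.exists_lab_eq_bot (V := V) (L := L)
    have hbot := Pomset.isBot_cls_of_lab_eq_bot hb
    rw [Pomset.Pom.le_antisymm (hA _) (hbot A), Pomset.Pom.le_antisymm (hB _) (hbot B)]
    change IsBot (seq (Pomset.fcls α hα).1 (Pomset.fcls α hα).1)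
    rw [hfin]
    refine Pomset.FinPom.isBot_seq (hseqFin _ _) fun β hβ y hy => ?_
    obtain ⟨k, hk⟩ := Pomset.LPO.iso_iff.1 hβ
    obtain ⟨x, hx, rfl⟩ := hk.bijOn.surjOn hy
    rw [hk.lab_eq x hx, hb x hx]
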